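/- **Setting.** A relation is a finite set of assignments of values to the variables in its scope; its size is its number of tuples. $\bowtie$, $\ltimes$, $\Pi_W$ denote natural join, semijoin and projection on $W$. Let $\mathcal J$ be a CSP instance, i.e. a finite set of constraints (scope, constraint relation) over finitely many variables. An e-join tree for $\mathcal J$ is an ordered rooted tree $T$, strictly binary (every non-leaf vertex has exactly two children), each vertex of which is a constraint of $\mathcal J$, such that every constraint of $\mathcal J$ occurs in $T$ and the variables shared by two vertices occur in all vertices of the path connecting them. During the computation every vertex $v$ holds a relation $rel(v)$ with scope $sch(v)=ret(v)\cup iet(v)$; initially $ret(v)$ is the scope of the constraint $v$, $iet(v)=\emptyset$, and $rel(v)$ is its constraint relation. **Operations.** Vertices get marked; below, leaves, depths and "the tree" refer to the unmarked vertices. * $shunt(w)$ at an unmarked leaf $l$ of depth $>1$, with parent $p$, other unmarked child $s$ of $p$, and $q$ the parent of $p$: let $C=rel(l)\bowtie(rel(p)\ltimes rel(q))\bowtie rel(s)$. Save the constraint $s_w$ with the old scope $sch(s)$ and relation $\Pi_{sch(s)}C$; mark $l,p$ with $w$; $s$ takes the place of $p$ as a child of $q$, and $p$ becomes a marked child of $s$;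 $ret(s)$ is unchanged, $iet(s):=(ret(q)\cap sch(p))\setminus ret(s)$; the relations of $s$ (on its new scope), $p$ and $l$ become the projections of $C$ on their scopes. * $r\text{-}shunt(w)$ on a pair $l,p$ with mark $w$, $p$ the parent of $l$, $s$ the parent of $p$, $q$ the parent of $s$: unmark $l,p$; $p$ takes the place of $s$ as a child of $q$, and $s$ becomes a child of $p$; then $rel(p):=\Pi_{ret(p)}\big((rel(p)\ltimes rel(q))\ltimes(rel(s_w)\ltimes rel(s))\big)$, $rel(l):=\Pi_{ret(l)}(rel(l)\ltimes rel(p))$, $iet(p):=iet(l):=\emptyset$. **GLOBAL-CONSISTENCY.** Label the leaves $1,2,\dots$ from left to right. *Ascending phase:* while the tree has depth $>1$: increment the mark $w$ and apply $shunt(w)$ in parallel to all unmarked odd-labelled leaves of depth $>1$ that are left children; increment $w$ and do the same for those that are right children; shift out the rightmost bit of the labels of the remaining leaves. *Then*, if the root $p$ has children $p',p''$: $rel(p):=rel(p)\ltimes rel(p')\ltimes rel(p'')$; $rel(p'):=\Pi_{ret(p')}(rel(p')\ltimes rel(p))$, $iet(p'):=\emptyset$, and likewise for $p''$. *Descending phase:*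 for $w$ from the last mark down to $1$, apply $r\text{-}shunt(w)$ in parallel to all pairs with mark $w$. On a parallel DB-machine with $c\ge 1$ processors, a parallel shunt operation is the simultaneous execution, within one parallel step, of at most $c$ shunts, or at most $c$ reverse shunts, one per processor (all processors read the state at the beginning of the step, and no two of them write on the same vertex); an instruction that requires $k$ (reverse) shunts in parallel is executed by dividing them into $\lceil k/c\rceil$ parallel operations. **Theorem.** There is an absolute constant $K$ such that, for every CSP instance $\mathcal J$, every e-join tree $T$ for $\mathcal J$ with $n$ vertices, every $c\ge1$ and every way of dividing the operations among the $c$ processors as above, GLOBAL-CONSISTENCY terminates on $T$, its parallel steps are legal for the machine with $c$ processors (at most $c$ operations, exclusive writes), and (a) it performs, in the two phases together, a sequence of at most $4\left(\lceil\log_2 c\rceil+2\left\lceil\frac{n}{4c}\right\rceil\right)$ parallel shunt operations (reverse ones included); (b) the number of all the intermediate relations that it computes and stores (relations of the vertices and of the saved constraints $s_w$) is at most $K\,n$, and each of them has size at most $K\,d^2$, where $d$ is the size of the largest constraint relation of $\mathcal J$. -/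

import Mathlib

namespace GlobCons

/-! ### Constraint relations and relational algebra

A (partial) assignment of values in `D` to variables in `X` is a function `X → Option D`;
the variables on which it is defined are those not sent to `none`.  A relation is a finite set of
assignments, and its size is the number of its tuples. -/

abbrev Assignment (X D : Type*) := X → Option D

abbrev Relation (X D : Type*) := Finset (Assignment X D)

section Algebra

variable {X D : Type*}

/-- Restriction of an assignment to the variables in `W`. -/
def restrict [DecidableEq X] (W : Finset X) (θ : Assignment X D) : Assignment X D :=
  fun x => if x ∈ W then θ x else none

/-- Two assignments agree on all variables on which both are defined. -/
def Compatible (θ η : Assignment X D) : Prop :=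
  ∀ x, θ x = none ∨ η x = none ∨ θ x = η x

instance [Fintype X] [DecidableEq D] (θ η : Assignment X D) : Decidable (Compatible θ η) :=
  inferInstanceAs (Decidable (∀ x, θ x = none ∨ η x = none ∨ θ x = η x))

/-- Union of two (compatible) assignments. -/
def merge (θ η : Assignment X D) : Assignment X D :=
  fun x => (θ x).or (η x)

variable [Fintype X] [DecidableEq X] [DecidableEq D]

/-- Projection of `R` on the variables in `W`. -/
def proj (W : Finset X) (R : Relation X D) : Relation X D :=
  R.image (restrict W)

/-- Natural join of `R` and `S`. -/
def join (R S : Relation X D) : Relation X D :=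
  ((R ×ˢ S).filter (fun z => Compatible z.1 z.2)).image (fun z => merge z.1 z.2)

/-- Semijoin `R ⋉ S`: the tuples of `R` that match some tuple of `S`. -/
def semijoin (R S : Relation X D) : Relation X D :=
  R.filter (fun θ => ∃ η ∈ S, Compatible θ η)

end Algebra

/-! ### CSP instances -/

/-- A constraint: a scope and a finite set of assignments whose domain is the scope. -/
structure Constraint (X D : Type*) where
  scope : Finset X
  rel : Relation X D
  dom_eq : ∀ θ ∈ rel, ∀ x, θ x ≠ none ↔ x ∈ scope

/-- A CSP instance: a finite set of constraints. -/
structure CSP (X D : Type*) where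
  constraints : Finset (Constraint X D)

/-- The size (number of tuples) of the largest constraint relation. -/
def CSP.maxRelSize {X D : Type*} (J : CSP X D) : ℕ :=
  J.constraints.sup (fun C => C.rel.card)

/-! ### Ordered strictly binary trees -/

/-- Strictly binary trees with ordered children, whose vertices carry names in `V`. -/
inductive BTree (V : Type*) where
  | leaf (v : V) : BTree V
  | node (v : V) (a b : BTree V) : BTree V

namespace BTree

variable {V : Type*}

def root : BTree V → V
  | leaf v => v
  | node v _ _ => v

def verts : BTree V → List V
  | leaf v => [v]
  | node v a b => v :: (a.verts ++ b.verts)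

/-- The leaves, from left to right. -/
def leaves : BTree V → List V
  | leaf v => [v]
  | node _ a b => a.leaves ++ b.leaves

def depth : BTree V → ℕ
  | leaf _ => 0
  | node _ a b => 1 + max a.depth b.depth

variable [DecidableEq V]

/-- The parent of the vertex `u`, if there is one. -/
def parent (u : V) : BTree V → Option V
  | leaf _ => none
  | node v a b =>
      if a.root = u ∨ b.root = u then some v else (a.parent u).or (b.parent u)

/-- The tree is the one-vertex tree `l`. -/
def isLeaf (l : V) : BTree V → Bool
  | leaf v => decide (v = l)
  | node _ _ _ => false

/-- Delete the leaf `l` and its parent; the sibling subtree of `l` takes the place of the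
parent. -/
def contract (l : V) : BTree V → BTree V
  | leaf v => leaf v
  | node v a b =>
      if a.isLeaf l then b
      else if b.isLeaf l then a
      else node v (a.contract l) (b.contract l)

/-- The undirected graph of the tree. -/
def graph (t : BTree V) : SimpleGraph V :=
  SimpleGraph.fromRel (fun u v => t.parent v = some u)

end BTree

/-! ### e-join trees -/

/-- An e-join tree for `J` with vertices named by `V`, as given in input: a strictly binary tree
whose vertices are constraints of `J`, in which every constraint of `J` occurs, and such that the
variables shared by two vertices occur in all vertices on the path connecting them.  The partition
of the scopes is trivial in the input: see `initial`. -/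
structure EJoinTree {X D : Type*} [DecidableEq X] (J : CSP X D) (V : Type*) [DecidableEq V] where
  tree : BTree V
  nodup : tree.verts.Nodup
  mem_verts : ∀ v, v ∈ tree.verts
  con : V → Constraint X D
  con_mem : ∀ v, con v ∈ J.constraints
  con_surj : ∀ C ∈ J.constraints, ∃ v, con v = C
  connected : ∀ (v v' : V) (P : tree.graph.Path v v') (u : V), u ∈ P.1.support →
    (con v).scope ∩ (con v').scope ⊆ (con u).scope

/-- The number of vertices of the e-join tree. -/
def EJoinTree.size {X D V : Type*} [DecidableEq X] [DecidableEq V] {J : CSP X D}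
    (T : EJoinTree J V) : ℕ :=
  T.tree.verts.length

/-! ### States of the machine -/

/-- The constraint currently held by a vertex: its scope, partitioned into `ret` and `iet`, and its
relation. -/
structure VCon (X D : Type*) where
  ret : Finset X
  iet : Finset X
  rel : Relation X D

def VCon.sch {X D : Type*} [DecidableEq X] (C : VCon X D) : Finset X := C.ret ∪ C.iet

inductive Side where
  | left : Side
  | right : Side
  deriving DecidableEq

/-- A place where a shunt can be applied: an unmarked leaf `l` of depth greater than `1`, its parent
`p`, the other child `s` of `p`, the parent `q` of `p`; `side` tells which child of `p` is `l`. -/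
structure Site (V : Type*) where
  l : V
  p : V
  s : V
  q : V
  side : Side

/-- A pair of marked vertices `l`, `p` with mark `w`: in the current e-join tree `l` is a child of
`p` and `p` is a child of `s` (`side` tells on which side of `p` the leaf `l` is to be restored).
The record also holds the constraint `s_w` saved in the additional storage when `l` and `p` were
marked. -/
structure MarkedPair (V X D : Type*) where
  w : ℕ
  l : V
  p : V
  s : V
  side : Side
  sw : VCon X D

/-- The state of the machine.
* `tree`: the subtree of the current e-join tree induced by the unmarked vertices;
* `marked`: the marked part of the current e-join tree, and the additional storage;
* `con`: the constraints currently held by the (marked and unmarked) vertices;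
* `label`: the labels of the leaves;
* `mark`: the last mark used;
* `trace`: the parallel (reverse) shunt operations performed so far; for each of them there is a list
  with one entry for each processor in use, the set of vertices on which that processor writes;
* `computed`: all the relations computed and stored so far (with repetitions). -/
structure State (V X D : Type*) where
  tree : BTree V
  marked : List (MarkedPair V X D)
  con : V → VCon X D
  label : V → ℕ
  mark : ℕ
  trace : List (List (Finset V))
  computed : List (Relation X D)

/-- A rule dividing any list `A` of operations to be executed in parallel among `c` processors:
`A` is split into `⌈|A| / c⌉` batches of at most `c` operations each. -/
structure Scheduler (c : ℕ) (α : Type*) where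
  batches : List α → List (List α)
  perm : ∀ A, (batches A).flatten.Perm A
  length_le : ∀ A, ∀ B ∈ batches A, B.length ≤ c
  count : ∀ A, (batches A).length = ⌈(A.length : ℚ) / c⌉₊

theorem exists_batches {α : Type*} {c : ℕ} (hc : 1 ≤ c) (A : List α) :
    ∃ L : List (List α), L.flatten.Perm A ∧ (∀ B ∈ L, B.length ≤ c) ∧
      L.length = ⌈(A.length : ℚ) / c⌉₊ := by
  have hc' : (0 : ℚ) < c := by exact_mod_cast hc
  induction hn : A.length using Nat.strong_induction_on generalizing A with
  | _ n ih =>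
    subst hn
    rcases Nat.eq_zero_or_pos A.length with h0 | h0
    · exact ⟨[], by simp [List.length_eq_zero_iff.mp h0], by simp, by simp [h0]⟩
    · obtain ⟨L, h1, h2, h3⟩ := ih (A.drop c).length (by simp; omega) (A.drop c) rfl
      refine ⟨A.take c :: L, ?_, ?_, ?_⟩
      · simpa using (h1.append_left (A.take c)).trans (by simp)
      · intro B hB
        rcases List.mem_cons.mp hB with rfl | hB
        · simp
        · exact h2 B hB
      · rw [List.length_cons, h3, List.length_drop]
        rcases le_total c A.length with h | h
        · have h1 : (1 : ℚ) ≤ (A.length : ℚ) / c := by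
            rw [le_div_iff₀ hc']; simpa using h
          rw [Nat.cast_sub h, sub_div, div_self hc'.ne', Nat.ceil_sub_one]
          have := Nat.ceil_pos.mpr (lt_of_lt_of_le one_pos h1)
          omega
        · rw [Nat.sub_eq_zero_of_le h]
          simp only [Nat.cast_zero, zero_div, Nat.ceil_zero, zero_add]
          symm
          rw [Nat.ceil_eq_iff one_ne_zero]
          refine ⟨by simpa using div_pos (by exact_mod_cast h0) hc', ?_⟩
          rw [div_le_iff₀ hc']; simpa using h

/-- Schedulers exist for any positive number of processors. -/
theorem Scheduler.nonempty {c : ℕ} (hc : 1 ≤ c) (α : Type*) : Nonempty (Scheduler c α) := by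
  choose L h1 h2 h3 using fun A : List α => exists_batches hc A
  exact ⟨⟨L, h1, h2, h3⟩⟩

namespace BTree

variable {V : Type*}

/-- The sites in a subtree whose root has parent `q`. -/
def sitesBelow (q : V) : BTree V → List (Site V)
  | leaf _ => []
  | node p a b =>
      (match a with
        | leaf l => [⟨l, p, b.root, q, Side.left⟩]
        | node _ _ _ => []) ++
      (match b with
        | leaf l => [⟨l, p, a.root, q, Side.right⟩]
        | node _ _ _ => []) ++
      (a.sitesBelow p ++ b.sitesBelow p)

/-- All sites of a tree, one for each leaf of depth greater than `1`. -/
def sites : BTree V → List (Site V)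
  | leaf _ => []
  | node r a b => a.sitesBelow r ++ b.sitesBelow r

/-- Put `p` in the place of the root of `t`, with children `l` and `t`; `l` is on side `d`. -/
def attach (l p : V) (d : Side) (t : BTree V) : BTree V :=
  match d with
  | Side.left => node p (leaf l) t
  | Side.right => node p t (leaf l)

/-- Inverse of `contract`: put `p` in the place of `s`, with children `l` and `s`. -/
def expand [DecidableEq V] (l p s : V) (d : Side) : BTree V → BTree V
  | leaf v => if v = s then attach l p d (leaf v) else leaf v
  | node v a b =>
      if v = s then attach l p d (node v a b)
      else node v (a.expand l p s d) (b.expand l p s d)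

end BTree

section Algorithm

variable {V X D : Type*} [Fintype X] [DecidableEq X] [DecidableEq D] [DecidableEq V]

/-! ### The shunt operation -/

namespace State

/-- The relation `C = rel(l) ⋈ (rel(p) ⋉ rel(q)) ⋈ rel(s)`. -/
def shuntRel (S : State V X D) (x : Site V) : Relation X D :=
  join (join (S.con x.l).rel (semijoin (S.con x.p).rel (S.con x.q).rel)) (S.con x.s).rel

/-- The new constraint of `s`. -/
def shuntS (S : State V X D) (x : Site V) : VCon X D :=
  let ret' := (S.con x.s).ret
  let iet' := ((S.con x.q).ret ∩ (S.con x.p).sch) \ (S.con x.s).ret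
  ⟨ret', iet', proj (ret' ∪ iet') (S.shuntRel x)⟩

/-- The projection of `C` on the present scope of `v`, which is kept. It gives the new constraints
of `p` and `l`, and the constraint `s_w`. -/
def shuntKeep (S : State V X D) (x : Site V) (v : V) : VCon X D :=
  ⟨(S.con v).ret, (S.con v).iet, proj (S.con v).sch (S.shuntRel x)⟩

/-- `shunt(w)` performed by one processor at site `x`: everything is read from the state `S` at the
beginning of the parallel step, the results are written into `S'`. -/
def writeShunt (w : ℕ) (S S' : State V X D) (x : Site V) : State V X D :=
  { S' with
    tree := S'.tree.contract x.l
    marked := S'.marked ++ [⟨w, x.l, x.p, x.s, x.side, S.shuntKeep x x.s⟩]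
    con := Function.update (Function.update (Function.update S'.con
      x.s (S.shuntS x)) x.p (S.shuntKeep x x.p)) x.l (S.shuntKeep x x.l)
    computed := S'.computed ++
      [(S.shuntS x).rel, (S.shuntKeep x x.p).rel, (S.shuntKeep x x.l).rel,
        (S.shuntKeep x x.s).rel] }

/-- One parallel shunt operation: `shunt(w)` at all sites of `B`, one for each processor. -/
def parShunt (w : ℕ) (S : State V X D) (B : List (Site V)) : State V X D :=
  { B.foldl (S.writeShunt w) S with
    trace := S.trace ++ [B.map (fun x => {x.l, x.p, x.s})] }

/-! ### The reverse shunt operation -/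

/-- The new constraint of `p`; here `q` is the parent of `s` in the current tree. -/
def rshuntP (S : State V X D) (m : MarkedPair V X D) : VCon X D :=
  let R := match S.tree.parent m.s with
    | some q => semijoin (S.con m.p).rel (S.con q).rel
    | none => (S.con m.p).rel
  ⟨(S.con m.p).ret, ∅,
    proj (S.con m.p).ret (semijoin R (semijoin m.sw.rel (S.con m.s).rel))⟩

/-- The new constraint of `l`. -/
def rshuntL (S : State V X D) (m : MarkedPair V X D) : VCon X D :=
  ⟨(S.con m.l).ret, ∅,
    proj (S.con m.l).ret (semijoin (S.con m.l).rel (S.rshuntP m).rel)⟩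

/-- `r-shunt(w)` performed by one processor on a marked pair; `S` and `S'` are as in
`writeShunt`. -/
def writeRshunt (S S' : State V X D) (m : MarkedPair V X D) : State V X D :=
  { S' with
    tree := S'.tree.expand m.l m.p m.s m.side
    marked := S'.marked.filter (fun m' => m'.l ≠ m.l)
    con := Function.update (Function.update S'.con m.p (S.rshuntP m)) m.l (S.rshuntL m)
    computed := S'.computed ++ [(S.rshuntP m).rel, (S.rshuntL m).rel] }

/-- One parallel reverse shunt operation. -/
def parRshunt (S : State V X D) (B : List (MarkedPair V X D)) : State V X D :=
  { B.foldl S.writeRshunt S with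
    trace := S.trace ++ [B.map (fun m => {m.l, m.p, m.s})] }

/-! ### The algorithm -/

variable {c : ℕ}

/-- Instructions (a)-(b), resp. (c)-(d), of the while loop: increment the mark and apply `shunt` in
parallel to all unmarked odd leaves that are left, resp. right, children and have depth greater
than `1`. -/
def ascendSide (σ : Scheduler c (Site V)) (d : Side) (S : State V X D) : State V X D :=
  let A := S.tree.sites.filter (fun x => x.side = d ∧ Odd (S.label x.l))
  let S₁ := (σ.batches A).foldl (parShunt (S.mark + 1)) S
  { S₁ with mark := S.mark + 1 }

/-- Instruction (e): shift out the rightmost bit in the labels of the remaining leaves. -/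
def shiftLabels (S : State V X D) : State V X D :=
  { S with label := fun v => if v ∈ S.tree.leaves then S.label v / 2 else S.label v }

/-- The body of the while loop. -/
def ascendBody (σ : Scheduler c (Site V)) (S : State V X D) : State V X D :=
  ((S.ascendSide σ Side.left).ascendSide σ Side.right).shiftLabels

/-- `Ascends σ S S'`: the while loop, started in state `S`, terminates in state `S'`. -/
inductive Ascends (σ : Scheduler c (Site V)) : State V X D → State V X D → Prop
  | done (S : State V X D) : S.tree.depth ≤ 1 → Ascends σ S S
  | step (S S' : State V X D) :
      1 < S.tree.depth → Ascends σ (S.ascendBody σ) S' → Ascends σ S S'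

/-- The computation at the root `p` and its children `p'`, `p''` between the two phases (nothing
has to be done for a tree with one vertex only). -/
def middle (S : State V X D) : State V X D :=
  match S.tree with
  | .leaf _ => S
  | .node p a b =>
      let p' := a.root
      let p'' := b.root
      let R := semijoin (semijoin (S.con p).rel (S.con p').rel) (S.con p'').rel
      let R' := proj (S.con p').ret (semijoin (S.con p').rel R)
      let R'' := proj (S.con p'').ret (semijoin (S.con p'').rel R)
      { S with
        con := Function.update (Function.update (Function.update S.con
          p ⟨(S.con p).ret, (S.con p).iet, R⟩)
          p' ⟨(S.con p').ret, ∅, R'⟩) p'' ⟨(S.con p'').ret, ∅, R''⟩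
        computed := S.computed ++ [R, R', R''] }

/-- Apply `r-shunt(w)` in parallel to all pairs of adjacent vertices with mark `w`. -/
def descendMark (τ : Scheduler c (MarkedPair V X D)) (S : State V X D) (w : ℕ) : State V X D :=
  (τ.batches (S.marked.filter (fun m => m.w = w))).foldl parRshunt S

/-- The descending phase: `w` goes from `mark` down to `1`. -/
def descend (τ : Scheduler c (MarkedPair V X D)) (S : State V X D) : State V X D :=
  ((List.range S.mark).reverse.map (fun i => i + 1)).foldl (descendMark τ) S

end State

/-- The initial state: no vertex is marked, `iet` is empty for all vertices, and the leaves are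
labelled `1, 2, …` from left to right. -/
def EJoinTree.initial {J : CSP X D} (T : EJoinTree J V) : State V X D where
  tree := T.tree
  marked := []
  con v := ⟨(T.con v).scope, ∅, (T.con v).rel⟩
  label v := T.tree.leaves.idxOf v + 1
  mark := 0
  trace := []
  computed := []

/-- GLOBAL-CONSISTENCY, executed by `c` processors on the e-join tree `T` with the given schedulers,
terminates in the state `F`. -/
def GlobalConsistency {c : ℕ} (σ : Scheduler c (Site V)) (τ : Scheduler c (MarkedPair V X D))
    {J : CSP X D} (T : EJoinTree J V) (F : State V X D) : Prop :=
  ∃ S : State V X D, State.Ascends σ T.initial S ∧ F = S.middle.descend τ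

end Algorithm

end GlobCons

set_option linter.unusedSectionVars false

/-! Size. Every vertex keeps at most `d` tuples on its retained variables and at most `d ^ 2` in
all. A shunt leaves `ret(s)` alone and chooses the new `iet(s)` inside `ret(q) ∩ sch(p)`. Since
`rel(p)` is first semijoined with `rel(q)`, a new tuple of `s` is determined by a tuple of the old
`s` projected on `ret(s)` and a tuple of `q` projected on `ret(q)`, which gives at most `d * d`
tuples (`State.good_shuntS`). All other steps only select tuples, or project on retained variables.

Exclusive writes. Two shunts on the same side can meet only at the root of a sibling subtree, and
then their leaves are consecutive. Leaves of depth greater than `1` carry consecutive labels, so two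
such leaves are never both odd (`BTree.pairwise_indep_sites`). Moreover, removing odd leaves on the
left never moves another odd leaf to the other side, so the right pass catches all odd deep leaves
that remain (`BTree.IsSideList.deepLeaves_prune_prune`).

Number of operations. If the labels of deep leaves are at most `M`, one round performs at most `(M +
1) / 2` shunts and replaces `M` by `M / 2`. While `M > 2 * c` the costs of the rounds decrease
geometrically; afterwards each round costs at most two operations and there are logarithmically
many. The potential `ascendBound` combines both regimes and gives `2 * L + 4 * N`, where `c ≤ 2 ^ L`
and `n ≤ 4 * c * N`. The descending phase undoes the shunts mark by mark on the same sets of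
vertices, so it inherits legality and costs no more than the ascending phase; this doubles the
bound.

Number of relations. Each shunt removes a leaf for good, so there are fewer shunts than leaves, and
each shunt or reverse shunt stores boundedly many relations. -/

namespace GlobCons

/-! ### Sizes of relations -/

section RelationSize

variable {X D : Type*}

/-- `ζ` extends the assignment `θ`. -/
def Extends (ζ θ : Assignment X D) : Prop := ∀ x, θ x ≠ none → ζ x = θ x

theorem Extends.trans {ζ θ η : Assignment X D} (h₁ : Extends ζ θ) (h₂ : Extends θ η) :
    Extends ζ η := fun x hx => by
  rw [h₁ x (by rw [h₂ x hx]; exact hx), h₂ x hx]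

theorem extends_merge_left (θ η : Assignment X D) : Extends (merge θ η) θ := by
  intro x hx
  obtain ⟨a, ha⟩ := Option.ne_none_iff_exists'.mp hx
  simp [merge, ha]

theorem Compatible.extends_merge_right {θ η : Assignment X D} (h : Compatible θ η) :
    Extends (merge θ η) η := by
  intro x hx
  rcases h x with h | h | h
  · simp [merge, h]
  · exact absurd h hx
  · obtain ⟨a, ha⟩ := Option.ne_none_iff_exists'.mp hx
    simp [merge, h, ha]

variable [Fintype X] [DecidableEq X] [DecidableEq D]

theorem mem_join {R S : Relation X D} {ζ : Assignment X D} (h : ζ ∈ join R S) :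
    ∃ θ ∈ R, ∃ η ∈ S, Extends ζ θ ∧ Extends ζ η := by
  simp only [join, Finset.mem_image, Finset.mem_filter, Finset.mem_product, Prod.exists] at h
  obtain ⟨θ, η, ⟨⟨hθ, hη⟩, hc⟩, rfl⟩ := h
  exact ⟨θ, hθ, η, hη, extends_merge_left _ _, hc.extends_merge_right⟩

theorem semijoin_subset (R S : Relation X D) : semijoin R S ⊆ R := Finset.filter_subset _ _

theorem proj_subset_proj (W : Finset X) {R S : Relation X D} (h : R ⊆ S) :
    proj W R ⊆ proj W S := Finset.image_subset_image h

theorem restrict_ne_none {W : Finset X} {θ : Assignment X D} {x : X} :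
    restrict W θ x ≠ none ↔ x ∈ W ∧ θ x ≠ none := by
  by_cases hx : x ∈ W <;> simp [restrict, hx]

/-- The bounds on the constraint held by a vertex that the computation maintains: the tuples are
defined exactly on the scope, there are at most `d` of them on the retained variables, and at most
`d ^ 2` in all. -/
structure VCon.Good (d : ℕ) (C : VCon X D) : Prop where
  dom : ∀ θ ∈ C.rel, ∀ x, θ x ≠ none ↔ x ∈ C.sch
  card_proj : (proj C.ret C.rel).card ≤ d
  card_rel : C.rel.card ≤ d ^ 2

theorem VCon.Good.of_subset {d : ℕ} {C : VCon X D} (hC : C.Good d) {R : Relation X D}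
    (h : R ⊆ C.rel) : VCon.Good d ⟨C.ret, C.iet, R⟩ where
  dom θ hθ := hC.dom θ (h hθ)
  card_proj := (Finset.card_le_card (proj_subset_proj _ h)).trans hC.card_proj
  card_rel := (Finset.card_le_card h).trans hC.card_rel

/-- This covers the steps that empty `iet`: the whole new relation is then bounded by `d`, hence by
`d ^ 2`. -/
theorem VCon.Good.of_proj {d : ℕ} {C : VCon X D} (hC : C.Good d) {R : Relation X D}
    (h : R ⊆ C.rel) : VCon.Good d ⟨C.ret, ∅, proj C.ret R⟩ := by
  have hd : (proj C.ret R).card ≤ d :=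
    (Finset.card_le_card (proj_subset_proj _ h)).trans hC.card_proj
  refine ⟨fun θ hθ x => ?_, Finset.card_image_le.trans hd, hd.trans (Nat.le_self_pow two_ne_zero d)⟩
  obtain ⟨η, hη, rfl⟩ := Finset.mem_image.mp hθ
  rw [restrict_ne_none, hC.dom η (h hη)]
  simp only [VCon.sch, Finset.mem_union, Finset.notMem_empty, or_false]
  tauto

end RelationSize

/-! ### Preservation of the size bounds by the operations -/

section Shunt

variable {V X D : Type*} [Fintype X] [DecidableEq X] [DecidableEq D]

theorem State.mem_shuntRel {S : State V X D} {y : Site V} {ζ : Assignment X D}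
    (h : ζ ∈ S.shuntRel y) :
    (∃ θ ∈ (S.con y.l).rel, Extends ζ θ) ∧ (∃ θ ∈ (S.con y.s).rel, Extends ζ θ) ∧
      ∃ θ ∈ (S.con y.p).rel, Extends ζ θ ∧ ∃ η ∈ (S.con y.q).rel, Compatible θ η := by
  obtain ⟨θ, hθ, θs, hs, hζ, hζs⟩ := mem_join h
  obtain ⟨θl, hl, θp, hp, hθl, hθp⟩ := mem_join hθ
  obtain ⟨hp, η, hη, hc⟩ := Finset.mem_filter.mp hp
  exact ⟨⟨θl, hl, hζ.trans hθl⟩, ⟨θs, hs, hζs⟩, θp, hp, hζ.trans hθp, η, hη, hc⟩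

theorem VCon.Good.restrict_eq {d : ℕ} {C : VCon X D} (hC : C.Good d) {ζ θ : Assignment X D}
    (hθ : θ ∈ C.rel) (h : Extends ζ θ) {W : Finset X} (hW : W ⊆ C.sch) :
    restrict W ζ = restrict W θ := by
  funext x
  by_cases hx : x ∈ W
  · simp [restrict, hx, h x ((hC.dom θ hθ x).mpr (hW hx))]
  · simp [restrict, hx]

theorem VCon.Good.restrict_self {d : ℕ} {C : VCon X D} (hC : C.Good d) {θ : Assignment X D}
    (hθ : θ ∈ C.rel) : restrict C.sch θ = θ := by
  funext x
  by_cases hx : x ∈ C.sch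
  · simp [restrict, hx]
  · have := (hC.dom θ hθ x).not.mpr hx
    simp only [ne_eq, not_not] at this
    simp [restrict, hx, this]

/-- Every tuple of the join extends a tuple of `v`, and its restriction to the scope of `v` is that
tuple; so the projection merely selects tuples of `v`. -/
theorem State.good_shuntKeep {d : ℕ} {S : State V X D} (hS : ∀ v, (S.con v).Good d)
    {y : Site V} {v : V} (hv : v = y.l ∨ v = y.p ∨ v = y.s) : (S.shuntKeep y v).Good d := by
  refine (hS v).of_subset fun θ hθ => ?_
  obtain ⟨ζ, hζ, rfl⟩ := Finset.mem_image.mp hθ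
  obtain ⟨hl, hs, hp⟩ := State.mem_shuntRel hζ
  have : ∃ θ ∈ (S.con v).rel, Extends ζ θ := by
    rcases hv with rfl | rfl | rfl
    · exact hl
    · obtain ⟨θ, h₁, h₂, -⟩ := hp
      exact ⟨θ, h₁, h₂⟩
    · exact hs
  obtain ⟨θ, hθ, h⟩ := this
  rwa [(hS v).restrict_eq hθ h subset_rfl, (hS v).restrict_self hθ]

/-- The projection on `ret(s)` only selects from the old one. On `iet(s)` the values come from a
tuple of `p` compatible with a tuple of `q`, and these variables lie in `ret(q)`; two projections
with at most `d` tuples each therefore determine a new tuple. -/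
theorem State.good_shuntS {d : ℕ} {S : State V X D} (hS : ∀ v, (S.con v).Good d) (y : Site V) :
    (S.shuntS y).Good d := by
  set ret' := (S.con y.s).ret
  set iet' := ((S.con y.q).ret ∩ (S.con y.p).sch) \ (S.con y.s).ret with hiet
  have hret : ret' ⊆ (S.con y.s).sch := Finset.subset_union_left
  have hietp : iet' ⊆ (S.con y.p).sch := fun x hx =>
    (Finset.mem_inter.mp (Finset.mem_sdiff.mp hx).1).2
  have hietq : iet' ⊆ (S.con y.q).ret := fun x hx =>
    (Finset.mem_inter.mp (Finset.mem_sdiff.mp hx).1).1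
  refine ⟨fun θ hθ x => ?_, ?_, ?_⟩
  · obtain ⟨ζ, hζ, rfl⟩ := Finset.mem_image.mp hθ
    obtain ⟨-, ⟨θs, hs, hζs⟩, θp, hp, hζp, -⟩ := State.mem_shuntRel hζ
    rw [restrict_ne_none]
    refine and_iff_left_of_imp fun hx => ?_
    rcases Finset.mem_union.mp hx with hx | hx
    · have := ((hS _).dom _ hs x).mpr (hret hx)
      rwa [hζs x this]
    · have := ((hS _).dom _ hp x).mpr (hietp hx)
      rwa [hζp x this]
  · refine le_trans (Finset.card_le_card fun θ hθ => ?_) (hS y.s).card_proj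
    obtain ⟨η, hη, rfl⟩ := Finset.mem_image.mp hθ
    obtain ⟨ζ, hζ, rfl⟩ := Finset.mem_image.mp hη
    obtain ⟨-, ⟨θs, hs, hζs⟩, -⟩ := State.mem_shuntRel hζ
    refine Finset.mem_image.mpr ⟨θs, hs, ?_⟩
    rw [← (hS _).restrict_eq hs hζs hret]
    funext x
    by_cases hx : x ∈ ret'
    · have hx' : x ∈ (S.shuntS y).ret := hx
      simp [restrict, hx, hx', ret']
    · have hx' : x ∉ (S.shuntS y).ret := hx
      simp [restrict, hx, hx']
  · have key : (S.shuntS y).rel ⊆ Finset.image₂ (fun a b => merge a (restrict iet' b))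
        (proj ret' (S.con y.s).rel) (proj (S.con y.q).ret (S.con y.q).rel) := by
      intro θ hθ
      obtain ⟨ζ, hζ, rfl⟩ := Finset.mem_image.mp hθ
      obtain ⟨-, ⟨θs, hs, hζs⟩, θp, hp, hζp, θq, hq, hc⟩ := State.mem_shuntRel hζ
      refine Finset.mem_image₂.mpr ⟨_, Finset.mem_image_of_mem _ hs, _,
        Finset.mem_image_of_mem _ hq, ?_⟩
      funext x
      by_cases hx : x ∈ ret'
      · have h₁ := ((hS _).dom _ hs x).mpr (hret hx)
        have h₂ := hζs x h₁
        obtain ⟨a, ha⟩ := Option.ne_none_iff_exists'.mp h₁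
        have hx' : x ∈ (S.con y.s).ret := hx
        simp [merge, restrict, hx, hx', h₂, ha]
      · have hx' : x ∉ (S.con y.s).ret := hx
        by_cases hi : x ∈ iet'
        · have h₁ := ((hS _).dom _ hp x).mpr (hietp hi)
          have h₂ := ((hS _).dom _ hq x).mpr (Finset.mem_union_left _ (hietq hi))
          -- Both tuples are defined at `x`, so compatibility forces equality; this is where the
          -- semijoin with `rel(q)` enters.
          have h₃ : θp x = θq x := ((hc x).resolve_left h₁).resolve_left h₂
          have h₄ := hζp x h₁
          have h₅ := hietq hi
          have hi' := hi
          rw [hiet] at hi'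
          have hm : x ∈ ret' ∪ iet' := Finset.mem_union_right _ hi
          change _ = if x ∈ ret' ∪ iet' then ζ x else none
          simp only [merge, restrict, hx, hi, h₅, hm, if_true, if_false, Option.none_or]
          rw [h₄, h₃]
        · have hm : x ∉ ret' ∪ iet' := by simp [hx, hi]
          change _ = if x ∈ ret' ∪ iet' then ζ x else none
          simp only [merge, restrict, hx, hi, hm, if_false, Option.none_or]
    calc (S.shuntS y).rel.card ≤ _ := Finset.card_le_card key
      _ ≤ _ := Finset.card_image₂_le _ _ _
      _ ≤ d * d := Nat.mul_le_mul (hS y.s).card_proj (hS y.q).card_proj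
      _ = d ^ 2 := (sq d).symm

variable [DecidableEq V]

theorem State.good_rshuntP {d : ℕ} {S : State V X D} (hS : ∀ v, (S.con v).Good d)
    (m : MarkedPair V X D) : (S.rshuntP m).Good d := by
  refine (hS m.p).of_proj ((semijoin_subset _ _).trans ?_)
  split
  · exact semijoin_subset _ _
  · exact subset_rfl

theorem State.good_rshuntL {d : ℕ} {S : State V X D} (hS : ∀ v, (S.con v).Good d)
    (m : MarkedPair V X D) : (S.rshuntL m).Good d :=
  (hS m.l).of_proj (semijoin_subset _ _)

/-- All constraints held by the vertices satisfy the bounds of `VCon.Good`, and all relations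
computed so far have at most `d ^ 2` tuples. -/
structure State.Small (d : ℕ) (S : State V X D) : Prop where
  con : ∀ v, (S.con v).Good d
  computed : ∀ R ∈ S.computed, R.card ≤ d ^ 2

theorem good_update {d : ℕ} {f : V → VCon X D} (hf : ∀ v, (f v).Good d) {C : VCon X D}
    (hC : C.Good d) (u v : V) : (Function.update f u C v).Good d := by
  by_cases h : v = u
  · subst h
    simpa using hC
  · simpa [h] using hf v

theorem State.Small.writeShunt {d : ℕ} {w : ℕ} {S S' : State V X D} (hS : S.Small d)
    (hS' : S'.Small d) (y : Site V) : (S.writeShunt w S' y).Small d := by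
  have h₁ := State.good_shuntS hS.con y
  have h₂ := State.good_shuntKeep hS.con (y := y) (v := y.p) (by simp)
  have h₃ := State.good_shuntKeep hS.con (y := y) (v := y.l) (by simp)
  have h₄ := State.good_shuntKeep hS.con (y := y) (v := y.s) (by simp)
  refine ⟨good_update (good_update (good_update hS'.con h₁ _) h₂ _) h₃ _, fun R hR => ?_⟩
  simp only [State.writeShunt, List.mem_append, List.mem_cons, List.not_mem_nil, or_false] at hR
  rcases hR with h | rfl | rfl | rfl | rfl
  · exact hS'.computed R h
  exacts [h₁.card_rel, h₂.card_rel, h₃.card_rel, h₄.card_rel]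

theorem State.Small.parShunt {d : ℕ} {w : ℕ} {S : State V X D} (hS : S.Small d)
    (B : List (Site V)) : (S.parShunt w B).Small d := by
  have : ∀ S' : State V X D, S'.Small d → (B.foldl (S.writeShunt w) S').Small d := by
    induction B with
    | nil => exact fun _ h => h
    | cons y B ih => exact fun S' h => ih _ (hS.writeShunt h y)
  exact ⟨(this S hS).con, (this S hS).computed⟩

theorem State.Small.writeRshunt {d : ℕ} {S S' : State V X D} (hS : S.Small d)
    (hS' : S'.Small d) (m : MarkedPair V X D) : (S.writeRshunt S' m).Small d := by
  have h₁ := State.good_rshuntP hS.con m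
  have h₂ := State.good_rshuntL hS.con m
  refine ⟨good_update (good_update hS'.con h₁ _) h₂ _, fun R hR => ?_⟩
  simp only [State.writeRshunt, List.mem_append, List.mem_cons, List.not_mem_nil, or_false] at hR
  rcases hR with h | rfl | rfl
  · exact hS'.computed R h
  exacts [h₁.card_rel, h₂.card_rel]

theorem State.Small.parRshunt {d : ℕ} {S : State V X D} (hS : S.Small d)
    (B : List (MarkedPair V X D)) : (S.parRshunt B).Small d := by
  have : ∀ S' : State V X D, S'.Small d → (B.foldl S.writeRshunt S').Small d := by
    induction B with
    | nil => exact fun _ h => h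
    | cons y B ih => exact fun S' h => ih _ (hS.writeRshunt h y)
  exact ⟨(this S hS).con, (this S hS).computed⟩

theorem State.Small.ascendSide {c d : ℕ} {S : State V X D} (hS : S.Small d)
    (σ : Scheduler c (Site V)) (e : Side) : (S.ascendSide σ e).Small d := by
  have : ∀ (L : List (List (Site V))) (w : ℕ) (S : State V X D), S.Small d →
      (L.foldl (State.parShunt w) S).Small d := by
    intro L w
    induction L with
    | nil => exact fun _ h => h
    | cons B L ih => exact fun S h => ih _ (h.parShunt B)
  have := this (σ.batches (S.tree.sites.filter (fun x => x.side = e ∧ Odd (S.label x.l))))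
    (S.mark + 1) S hS
  exact ⟨this.con, this.computed⟩

theorem State.Small.ascendBody {c d : ℕ} {S : State V X D} (hS : S.Small d)
    (σ : Scheduler c (Site V)) : (S.ascendBody σ).Small d := by
  have := (hS.ascendSide σ Side.left).ascendSide σ Side.right
  exact ⟨this.con, this.computed⟩

theorem State.Ascends.small {c d : ℕ} {σ : Scheduler c (Site V)} {S S' : State V X D}
    (h : State.Ascends σ S S') (hS : S.Small d) : S'.Small d := by
  induction h with
  | done S _ => exact hS
  | step S S' _ _ ih => exact ih (hS.ascendBody σ)

theorem State.Small.middle {d : ℕ} {S : State V X D} (hS : S.Small d) : S.middle.Small d := by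
  unfold State.middle
  split
  · exact hS
  · rename_i p a b _
    have h₁ := (hS.con p).of_subset ((semijoin_subset
      (semijoin (S.con p).rel (S.con a.root).rel) (S.con b.root).rel).trans (semijoin_subset _ _))
    have h₂ := (hS.con a.root).of_proj (semijoin_subset (S.con a.root).rel
      (semijoin (semijoin (S.con p).rel (S.con a.root).rel) (S.con b.root).rel))
    have h₃ := (hS.con b.root).of_proj (semijoin_subset (S.con b.root).rel
      (semijoin (semijoin (S.con p).rel (S.con a.root).rel) (S.con b.root).rel))
    refine ⟨good_update (good_update (good_update hS.con h₁ _) h₂ _) h₃ _, fun R hR => ?_⟩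
    simp only [List.mem_append, List.mem_cons, List.not_mem_nil, or_false] at hR
    rcases hR with h | rfl | rfl | rfl
    · exact hS.computed R h
    exacts [h₁.card_rel, h₂.card_rel, h₃.card_rel]

theorem State.Small.descendMark {c d : ℕ} {S : State V X D} (hS : S.Small d)
    (τ : Scheduler c (MarkedPair V X D)) (w : ℕ) : (S.descendMark τ w).Small d := by
  unfold State.descendMark
  generalize τ.batches (S.marked.filter (fun m => m.w = w)) = L
  induction L generalizing S with
  | nil => exact hS
  | cons B L ih => exact ih (hS.parRshunt B)

theorem State.Small.descend {c d : ℕ} {S : State V X D} (hS : S.Small d)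
    (τ : Scheduler c (MarkedPair V X D)) : (S.descend τ).Small d := by
  unfold State.descend
  generalize (List.range S.mark).reverse.map (fun i => i + 1) = L
  induction L generalizing S with
  | nil => exact hS
  | cons w L ih => exact ih (hS.descendMark τ w)

theorem EJoinTree.small_initial {J : CSP X D} (T : EJoinTree J V) :
    T.initial.Small J.maxRelSize := by
  refine ⟨fun v => ?_, by simp [EJoinTree.initial]⟩
  have h : (T.con v).rel.card ≤ J.maxRelSize :=
    Finset.le_sup (f := fun C : Constraint X D => C.rel.card) (T.con_mem v)
  refine ⟨fun θ hθ x => ?_, Finset.card_image_le.trans h, h.trans (Nat.le_self_pow two_ne_zero _)⟩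
  simpa [EJoinTree.initial, VCon.sch] using (T.con v).dom_eq θ hθ x

end Shunt

/-! ### Leaves and sites of a tree -/

namespace BTree

variable {V : Type*}

theorem root_mem_verts (t : BTree V) : t.root ∈ t.verts := by
  cases t <;> simp [root, verts]

theorem leaves_sublist_verts (t : BTree V) : t.leaves.Sublist t.verts := by
  induction t with
  | leaf v => simp [leaves, verts]
  | node v a b iha ihb => exact (iha.append ihb).cons _

theorem leaves_ne_nil (t : BTree V) : t.leaves ≠ [] := by
  induction t with
  | leaf v => simp [leaves]
  | node v a b iha _ => simp [leaves, iha]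

/-- This converts the bound in terms of `n / (4c)` into one in terms of leaves over `2c`. -/
theorem length_verts_add_one (t : BTree V) : t.verts.length + 1 = 2 * t.leaves.length := by
  induction t with
  | leaf v => simp [leaves, verts]
  | node v a b iha ihb => simp only [leaves, verts, List.length_cons, List.length_append]; omega

/-- The leaves of a tree with more than one vertex, the empty list for a one-vertex tree. -/
def properLeaves : BTree V → List V
  | leaf _ => []
  | node _ a b => a.leaves ++ b.leaves

/-- The leaves of depth greater than `1`. -/
def deepLeaves : BTree V → List V
  | leaf _ => []
  | node _ a b => a.properLeaves ++ b.properLeaves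

theorem properLeaves_eq_leaves {t : BTree V} (h : t.properLeaves ≠ []) :
    t.properLeaves = t.leaves := by
  cases t with
  | leaf v => simp [properLeaves] at h
  | node v a b => rfl

theorem properLeaves_sublist_leaves (t : BTree V) : t.properLeaves.Sublist t.leaves := by
  cases t <;> simp [properLeaves, leaves]

/-- A leaf that is a child of the root is the first or the last leaf, so discarding the shallow
leaves keeps the rest contiguous. -/
theorem deepLeaves_infix_leaves (t : BTree V) : t.deepLeaves <:+: t.leaves := by
  cases t with
  | leaf v => simp [deepLeaves]
  | node v a b =>
    rcases a with u | ⟨u, a₁, a₂⟩ <;> rcases b with z | ⟨z, b₁, b₂⟩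
    · simp [deepLeaves, properLeaves]
    · exact (List.suffix_cons u _).isInfix
    · exact ⟨[], [z], by simp [deepLeaves, properLeaves, leaves]⟩
    · exact List.infix_rfl

theorem two_le_length_deepLeaves {t : BTree V} (h : 1 < t.depth) : 2 ≤ t.deepLeaves.length := by
  have h₁ : ∀ t : BTree V, 1 ≤ t.leaves.length := fun t =>
    List.length_pos_iff.mpr t.leaves_ne_nil
  cases t with
  | leaf v => simp [depth] at h
  | node v a b =>
    rcases a with u | ⟨u, a₁, a₂⟩ <;> rcases b with z | ⟨z, b₁, b₂⟩
    · simp [depth] at h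
    all_goals simp only [deepLeaves, properLeaves, List.length_append, List.length_nil]
    · have := h₁ b₁; have := h₁ b₂; omega
    · have := h₁ a₁; have := h₁ a₂; omega
    · have := h₁ a₁; have := h₁ a₂; omega

/-- Only a permutation: sites at a vertex are listed before those deeper in the tree, not from left
to right. -/
theorem map_l_sitesBelow_perm (q : V) (t : BTree V) :
    ((t.sitesBelow q).map Site.l).Perm t.properLeaves := by
  classical
  induction t generalizing q with
  | leaf v => simp [sitesBelow, properLeaves]
  | node p a b iha ihb =>
    have iha := iha p
    have ihb := ihb p
    rw [List.perm_iff_count] at iha ihb ⊢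
    intro z
    have iha := iha z
    have ihb := ihb z
    rcases a with u | ⟨u, a₁, a₂⟩ <;> rcases b with v | ⟨v, b₁, b₂⟩ <;>
      simp only [sitesBelow, properLeaves, leaves, List.map_append, List.map_cons, List.map_nil,
        List.count_append, List.count_nil] at iha ihb ⊢ <;> omega

theorem map_l_sites_perm (t : BTree V) : (t.sites.map Site.l).Perm t.deepLeaves := by
  cases t with
  | leaf v => simp [sites, deepLeaves]
  | node v a b =>
    simpa [sites, deepLeaves] using
      (map_l_sitesBelow_perm v a).append (map_l_sitesBelow_perm v b)

theorem l_mem_leaves {q : V} {t : BTree V} {x : Site V} (h : x ∈ t.sitesBelow q) :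
    x.l ∈ t.leaves :=
  t.properLeaves_sublist_leaves.subset
    ((map_l_sitesBelow_perm q t).mem_iff.mp (List.mem_map_of_mem h))

theorem mem_sitesBelow_node {q p : V} {a b : BTree V} {x : Site V} :
    x ∈ (node p a b).sitesBelow q ↔
      (∃ l, a = leaf l ∧ x = ⟨l, p, b.root, q, Side.left⟩) ∨
      (∃ l, b = leaf l ∧ x = ⟨l, p, a.root, q, Side.right⟩) ∨
      x ∈ a.sitesBelow p ∨ x ∈ b.sitesBelow p := by
  cases a <;> cases b <;> simp [sitesBelow, or_assoc]

theorem p_mem_verts {q : V} {t : BTree V} {x : Site V} (h : x ∈ t.sitesBelow q) :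
    x.p ∈ t.verts := by
  induction t generalizing q with
  | leaf v => simp [sitesBelow] at h
  | node p a b iha ihb =>
    simp only [verts, List.mem_cons, List.mem_append]
    rcases mem_sitesBelow_node.mp h with ⟨l, -, rfl⟩ | ⟨l, -, rfl⟩ | h | h
    exacts [Or.inl rfl, Or.inl rfl, Or.inr (Or.inl (iha h)), Or.inr (Or.inr (ihb h))]

theorem s_mem_verts {q : V} {t : BTree V} {x : Site V} (h : x ∈ t.sitesBelow q) :
    x.s ∈ t.verts := by
  induction t generalizing q with
  | leaf v => simp [sitesBelow] at h
  | node p a b iha ihb =>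
    simp only [verts, List.mem_cons, List.mem_append]
    rcases mem_sitesBelow_node.mp h with ⟨l, -, rfl⟩ | ⟨l, -, rfl⟩ | h | h
    exacts [Or.inr (Or.inr b.root_mem_verts), Or.inr (Or.inl a.root_mem_verts),
      Or.inr (Or.inl (iha h)), Or.inr (Or.inr (ihb h))]

/-- The vertices on which a shunt at `x` writes. -/
def _root_.GlobCons.Site.writes [DecidableEq V] (x : Site V) : Finset V := {x.l, x.p, x.s}

/-! ### Disjointness of the vertices written by parallel shunts -/

variable [DecidableEq V]

theorem writes_subset_verts {q : V} {t : BTree V} {x : Site V} (h : x ∈ t.sitesBelow q) {v : V}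
    (hv : v ∈ x.writes) : v ∈ t.verts := by
  simp only [Site.writes, Finset.mem_insert, Finset.mem_singleton] at hv
  rcases hv with rfl | rfl | rfl
  exacts [t.leaves_sublist_verts.subset (l_mem_leaves h), p_mem_verts h, s_mem_verts h]

/-- Where the root of a subtree can be written on: only by the shunts at its children. -/
theorem root_mem_writes {q : V} {t : BTree V} (ht : t.verts.Nodup) {x : Site V}
    (h : x ∈ t.sitesBelow q) (hr : t.root ∈ x.writes) :
    (x.side = Side.left → t.leaves.head? = some x.l) ∧
      (x.side = Side.right → t.leaves.getLast? = some x.l) := by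
  cases t with
  | leaf v => simp [sitesBelow] at h
  | node p a b =>
    simp only [verts, List.nodup_cons, List.mem_append, not_or] at ht
    rw [mem_sitesBelow_node] at h
    rcases h with ⟨l, rfl, rfl⟩ | ⟨l, rfl, rfl⟩ | h | h
    · simp [leaves]
    · simp [leaves]
    · exact absurd (writes_subset_verts h hr) ht.1.1
    · exact absurd (writes_subset_verts h hr) ht.1.2

/-- No two consecutive elements of the list satisfy `O`. -/
def _root_.GlobCons.Sparse (O : V → Prop) (L : List V) : Prop :=
  L.IsChain (fun u v => ¬ (O u ∧ O v))

/-- The only vertex that can be shared is the root of `b`. A left shunt in `b` that writes on it is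
performed at the first leaf of `b`, which comes directly after `u`. -/
theorem disjoint_left_site {p q u : V} {b : BTree V} {O : V → Prop}
    (hv : (node p (leaf u) b).verts.Nodup) (hO : Sparse O (node p (leaf u) b).leaves)
    (hu : O u) {y : Site V} (hy : y ∈ b.sitesBelow q) (hs : y.side = Side.left) (hl : O y.l) :
    Disjoint ({u, p, b.root} : Finset V) y.writes := by
  simp only [verts, List.singleton_append, List.nodup_cons, List.mem_cons, not_or] at hv
  rw [Finset.disjoint_left]
  intro z hz hzy
  simp only [Finset.mem_insert, Finset.mem_singleton] at hz
  rcases hz with rfl | rfl | rfl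
  · exact hv.2.1 (writes_subset_verts hy hzy)
  · exact hv.1.2 (writes_subset_verts hy hzy)
  · have := (root_mem_writes hv.2.2 hy hzy).1 hs
    simp only [Sparse, leaves, List.singleton_append, List.isChain_cons] at hO
    exact hO.1 _ this ⟨hu, hl⟩

theorem disjoint_right_site {p q u : V} {a : BTree V} {O : V → Prop}
    (hv : (node p a (leaf u)).verts.Nodup) (hO : Sparse O (node p a (leaf u)).leaves)
    (hu : O u) {y : Site V} (hy : y ∈ a.sitesBelow q) (hs : y.side = Side.right) (hl : O y.l) :
    Disjoint ({u, p, a.root} : Finset V) y.writes := by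
  simp only [verts, List.nodup_cons, List.mem_append, not_or, List.nodup_append,
    List.mem_singleton] at hv
  rw [Finset.disjoint_left]
  intro z hz hzy
  simp only [Finset.mem_insert, Finset.mem_singleton] at hz
  rcases hz with rfl | rfl | rfl
  · exact hv.2.2.2 _ (writes_subset_verts hy hzy) _ rfl rfl
  · exact hv.1.1 (writes_subset_verts hy hzy)
  · have := (root_mem_writes hv.2.1 hy hzy).2 hs
    simp only [Sparse, leaves, List.isChain_append] at hO
    exact hO.2.2 _ this u rfl ⟨hl, hu⟩

/-- Shunts on the same side at leaves no two of which are consecutive write on disjoint sets. -/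
def _root_.GlobCons.Site.Indep (O : V → Prop) (x y : Site V) : Prop :=
  x.side = y.side → O x.l → O y.l → Disjoint x.writes y.writes

theorem indep_of_disjoint {q q' : V} {a b : BTree V} {O : V → Prop}
    (h : ∀ v ∈ a.verts, ∀ w ∈ b.verts, v ≠ w) {x y : Site V} (hx : x ∈ a.sitesBelow q)
    (hy : y ∈ b.sitesBelow q') : Site.Indep O x y := fun _ _ _ =>
  Finset.disjoint_left.mpr fun _ hzx hzy =>
    h _ (writes_subset_verts hx hzx) _ (writes_subset_verts hy hzy) rfl

theorem pairwise_indep_sitesBelow {q : V} {t : BTree V} {O : V → Prop} (hv : t.verts.Nodup)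
    (hO : Sparse O t.leaves) : (t.sitesBelow q).Pairwise (Site.Indep O) := by
  induction t generalizing q with
  | leaf v => simp [sitesBelow]
  | node p a b iha ihb =>
    have hv' := hv
    simp only [verts, List.nodup_cons, List.nodup_append] at hv'
    have hO' := hO
    simp only [Sparse, leaves, List.isChain_append] at hO'
    have iha := iha (q := p) hv'.2.1 hO'.1
    have ihb := ihb (q := p) hv'.2.2.1 hO'.2.1
    have hab : ∀ x ∈ a.sitesBelow p, ∀ y ∈ b.sitesBelow p, Site.Indep O x y :=
      fun x hx y hy => indep_of_disjoint hv'.2.2.2 hx hy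
    rcases a with u | ⟨u, a₁, a₂⟩ <;> rcases b with v | ⟨v, b₁, b₂⟩
    -- Two sibling leaves lie on different sides, so nothing is claimed about them.
    · simp [sitesBelow, Site.Indep]
    · rw [sitesBelow, List.append_nil, List.singleton_append, List.pairwise_cons]
      refine ⟨fun y hy h₁ h₂ h₃ => ?_, List.pairwise_append.mpr ⟨iha, ihb, hab⟩⟩
      exact disjoint_left_site hv hO h₂ (by simpa [sitesBelow] using hy) h₁.symm h₃
    · rw [sitesBelow, List.nil_append, List.singleton_append, List.pairwise_cons]
      refine ⟨fun y hy h₁ h₂ h₃ => ?_, List.pairwise_append.mpr ⟨iha, ihb, hab⟩⟩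
      exact disjoint_right_site hv hO h₂ (by simpa [sitesBelow] using hy) h₁.symm h₃
    · rw [sitesBelow, List.nil_append, List.nil_append]
      exact List.pairwise_append.mpr ⟨iha, ihb, hab⟩

/-- Sparsity is needed only inside each child of the root, since shunts in the two subtrees write on
different vertices. -/
theorem pairwise_indep_sites {t : BTree V} {O : V → Prop} (hv : t.verts.Nodup)
    (hO : ∀ v a b, t = node v a b → Sparse O a.properLeaves ∧ Sparse O b.properLeaves) :
    t.sites.Pairwise (Site.Indep O) := by
  cases t with
  | leaf v => simp [sites]
  | node v a b =>
    obtain ⟨ha, hb⟩ := hO v a b rfl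
    simp only [verts, List.nodup_cons, List.nodup_append] at hv
    have key : ∀ t : BTree V, t.verts.Nodup → Sparse O t.properLeaves →
        (t.sitesBelow v).Pairwise (Site.Indep O) := by
      intro t ht hO
      cases t with
      | leaf u => simp [sitesBelow]
      | node u a b => exact pairwise_indep_sitesBelow ht hO
    exact List.pairwise_append.mpr ⟨key a hv.2.1 ha, key b hv.2.2.1 hb,
      fun x hx y hy => indep_of_disjoint hv.2.2.2 hx hy⟩

/-- On each side there is a leaf at which no shunt of that side is possible. -/
theorem exists_leaf_not_site (q : V) {t : BTree V} (ht : t.leaves.Nodup) (d : Side) :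
    ∃ z ∈ t.leaves, ∀ x ∈ t.sitesBelow q, x.side = d → x.l ≠ z := by
  induction t generalizing q with
  | leaf v => exact ⟨v, by simp [leaves], by simp [sitesBelow]⟩
  | node p a b iha ihb =>
    simp only [leaves, List.nodup_append] at ht
    cases d with
    | left =>
      -- The recursion into `b` leads to the rightmost leaf, which is never a left child inside the
      -- subtree.
      obtain ⟨z, hz, h⟩ := ihb p ht.2.1
      refine ⟨z, by simp [leaves, hz], fun x hx hs => ?_⟩
      rw [mem_sitesBelow_node] at hx
      rcases hx with ⟨l, rfl, rfl⟩ | ⟨l, rfl, rfl⟩ | hx | hx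
      · exact ht.2.2 _ (by simp [leaves]) _ hz
      · simp at hs
      · exact ht.2.2 _ (l_mem_leaves hx) _ hz
      · exact h x hx hs
    | right =>
      obtain ⟨z, hz, h⟩ := iha p ht.1
      refine ⟨z, by simp [leaves, hz], fun x hx hs => ?_⟩
      rw [mem_sitesBelow_node] at hx
      rcases hx with ⟨l, rfl, rfl⟩ | ⟨l, rfl, rfl⟩ | hx | hx
      · simp at hs
      · exact (ht.2.2 _ hz _ (by simp [leaves])).symm
      · exact h x hx hs
      · exact (ht.2.2 _ hz _ (l_mem_leaves hx)).symm

/-! ### Contractions -/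

theorem isLeaf_iff {t : BTree V} {l : V} : t.isLeaf l = true ↔ t = leaf l := by
  cases t <;> simp [isLeaf]

theorem contract_node_cases (l v : V) (a b : BTree V) :
    (a = leaf l ∧ (node v a b).contract l = b) ∨
      (b = leaf l ∧ (node v a b).contract l = a) ∨
      (a ≠ leaf l ∧ b ≠ leaf l ∧
        (node v a b).contract l = node v (a.contract l) (b.contract l)) := by
  by_cases ha : a = leaf l
  · exact Or.inl ⟨ha, by simp [contract, isLeaf_iff, ha]⟩
  · by_cases hb : b = leaf l
    · exact Or.inr (Or.inl ⟨hb, by simp [contract, isLeaf_iff, ha, hb]⟩)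
    · exact Or.inr (Or.inr ⟨ha, hb, by simp [contract, isLeaf_iff, ha, hb]⟩)

theorem verts_contract_sublist (l : V) (t : BTree V) : (t.contract l).verts.Sublist t.verts := by
  induction t with
  | leaf v => exact List.Sublist.refl _
  | node v a b iha ihb =>
    rcases contract_node_cases l v a b with ⟨-, h⟩ | ⟨-, h⟩ | ⟨-, -, h⟩ <;> rw [h]
    · exact (List.sublist_append_right _ _).cons _
    · exact (List.sublist_append_left _ _).cons _
    · exact (iha.append ihb).cons_cons _

/-- The one-vertex tree `leaf l` is excluded because `contract` leaves it unchanged. -/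
theorem leaves_contract {l : V} {t : BTree V} (ht : t.leaves.Nodup) (hl : t ≠ leaf l) :
    (t.contract l).leaves = t.leaves.filter (fun v => v ≠ l) := by
  induction t with
  | leaf v =>
    have : v ≠ l := fun h => hl (by rw [h])
    simp [contract, leaves, this]
  | node v a b iha ihb =>
    simp only [leaves, List.nodup_append] at ht
    rcases contract_node_cases l v a b with ⟨rfl, h⟩ | ⟨rfl, h⟩ | ⟨ha, hb, h⟩ <;> rw [h]
    · have : b.leaves.filter (fun v => v ≠ l) = b.leaves := by
        rw [List.filter_eq_self]
        intro z hz
        simpa using (ht.2.2 l (by simp [leaves]) z hz).symm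
      simpa [leaves] using this.symm
    · have : a.leaves.filter (fun v => v ≠ l) = a.leaves := by
        rw [List.filter_eq_self]
        intro z hz
        simpa using ht.2.2 z hz l (by simp [leaves])
      simpa [leaves] using this.symm
    · rw [leaves, iha ht.1 ha, ihb ht.2.1 hb, leaves, List.filter_append]

/-- Contraction at a leaf with property `O` does not change the side of the leaves with that
property, if no two of them are consecutive. -/
theorem exists_site_of_contract {l : V} {t : BTree V} {O : V → Prop} (hO : Sparse O t.leaves)
    (hl : O l) {q : V} {x : Site V} (hx : x ∈ (t.contract l).sitesBelow q) (hxO : O x.l) :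
    ∃ y ∈ t.sitesBelow q, y.l = x.l ∧ y.side = x.side := by
  -- The vertex above the subtree enters a site only through its field `q`.
  have change : ∀ (t : BTree V) (q q' : V) (x : Site V), x ∈ t.sitesBelow q →
      ∃ y ∈ t.sitesBelow q', y.l = x.l ∧ y.side = x.side := by
    intro t q q' x hx
    cases t with
    | leaf v => simp [sitesBelow] at hx
    | node p a b =>
      rw [mem_sitesBelow_node] at hx
      rcases hx with ⟨l, ha, rfl⟩ | ⟨l, hb, rfl⟩ | hx | hx
      · exact ⟨_, mem_sitesBelow_node.mpr (Or.inl ⟨l, ha, rfl⟩), rfl, rfl⟩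
      · exact ⟨_, mem_sitesBelow_node.mpr (Or.inr (Or.inl ⟨l, hb, rfl⟩)), rfl, rfl⟩
      · exact ⟨x, mem_sitesBelow_node.mpr (by tauto), rfl, rfl⟩
      · exact ⟨x, mem_sitesBelow_node.mpr (by tauto), rfl, rfl⟩
  -- A side can change only through the loss of a sibling. A subtree shrinks to `leaf z` only if it
  -- already was that leaf, or if its children were the consecutive leaves `l` and `z`, which
  -- sparsity forbids.
  have leaf_of : ∀ (t : BTree V) (z : V), Sparse O t.leaves → O z → t.contract l = leaf z →
      t = leaf z := by
    intro t z hO hz h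
    cases t with
    | leaf v => exact h
    | node v a b =>
      rcases contract_node_cases l v a b with ⟨rfl, h'⟩ | ⟨rfl, h'⟩ | ⟨ha, hb, h'⟩
      · rw [h'] at h
        subst h
        simp [Sparse, leaves, hl, hz] at hO
      · rw [h'] at h
        subst h
        simp [Sparse, leaves, hl, hz] at hO
      · rw [h'] at h
        cases h
  induction t generalizing q with
  | leaf v => simp [contract, sitesBelow] at hx
  | node v a b iha ihb =>
    have hO' := hO
    simp only [Sparse, leaves, List.isChain_append] at hO'
    rcases contract_node_cases l v a b with ⟨rfl, h⟩ | ⟨rfl, h⟩ | ⟨ha, hb, h⟩ <;> rw [h] at hx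
    · obtain ⟨y, hy, h⟩ := change _ _ v _ hx
      exact ⟨y, mem_sitesBelow_node.mpr (by tauto), h⟩
    · obtain ⟨y, hy, h⟩ := change _ _ v _ hx
      exact ⟨y, mem_sitesBelow_node.mpr (by tauto), h⟩
    · rw [mem_sitesBelow_node] at hx
      rcases hx with ⟨z, hz, rfl⟩ | ⟨z, hz, rfl⟩ | hx | hx
      · have := leaf_of a z hO'.1 hxO hz
        exact ⟨_, mem_sitesBelow_node.mpr (Or.inl ⟨z, this, rfl⟩), rfl, rfl⟩
      · have := leaf_of b z hO'.2.1 hxO hz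
        exact ⟨_, mem_sitesBelow_node.mpr (Or.inr (Or.inl ⟨z, this, rfl⟩)), rfl, rfl⟩
      · obtain ⟨y, hy, h⟩ := iha hO'.1 hx
        exact ⟨y, mem_sitesBelow_node.mpr (by tauto), h⟩
      · obtain ⟨y, hy, h⟩ := ihb hO'.2.1 hx
        exact ⟨y, mem_sitesBelow_node.mpr (by tauto), h⟩

end BTree

/-- The successor of an element with property `O` lacks it and is kept, so it still separates that
element from the next one with property `O`. -/
theorem Sparse.filter {V : Type*} {O : V → Prop} {L : List V} (h : Sparse O L) {P : V → Bool}
    (hP : ∀ v ∈ L, ¬ O v → P v = true) : Sparse O (L.filter P) := by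
  induction L with
  | nil => simpa using h
  | cons x L ih =>
    have ih := ih (List.isChain_cons.mp h).2 fun v hv => hP v (by simp [hv])
    by_cases hx : P x = true
    · rw [List.filter_cons_of_pos hx]
      refine List.isChain_cons.mpr ⟨fun z hz => ?_, ih⟩
      rintro ⟨h₁, h₂⟩
      cases L with
      | nil => simp at hz
      | cons y L =>
        have hy : ¬ O y := fun hy => (List.isChain_cons.mp h).1 y rfl ⟨h₁, hy⟩
        rw [List.filter_cons_of_pos (hP y (by simp) hy)] at hz
        simp only [List.head?_cons, Option.mem_def, Option.some.injEq] at hz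
        exact hy (hz ▸ h₂)
    · rwa [List.filter_cons_of_neg hx]

/-! ### Successive contractions -/

namespace BTree

variable {V : Type*} [DecidableEq V]

/-- The tree obtained by contracting at all leaves of a list. -/
def prune (t : BTree V) (ls : List V) : BTree V := ls.foldl (fun t l => t.contract l) t

theorem verts_prune_sublist (t : BTree V) (ls : List V) : (t.prune ls).verts.Sublist t.verts := by
  induction ls generalizing t with
  | nil => exact List.Sublist.refl _
  | cons l ls ih => exact (ih _).trans (verts_contract_sublist l t)

theorem leaves_nodup {t : BTree V} (ht : t.verts.Nodup) : t.leaves.Nodup :=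
  ht.sublist t.leaves_sublist_verts

theorem ne_leaf_of_mem {t : BTree V} {l z : V} (hz : z ∈ t.leaves) (h : z ≠ l) : t ≠ leaf l := by
  rintro rfl
  exact h (by simpa [leaves] using hz)

theorem mem_leaves_contract {t : BTree V} (ht : t.verts.Nodup) {l z : V} (hz : z ∈ t.leaves)
    (h : z ≠ l) : z ∈ (t.contract l).leaves := by
  rw [leaves_contract (leaves_nodup ht) (ne_leaf_of_mem hz h)]
  simp [hz, h]

theorem leaves_prune {t : BTree V} (ht : t.verts.Nodup) {ls : List V}
    (h : ∃ z ∈ t.leaves, z ∉ ls) : (t.prune ls).leaves = t.leaves.filter (fun v => v ∉ ls) := by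
  induction ls generalizing t with
  | nil => simp [prune]
  | cons l ls ih =>
    obtain ⟨z, hz, hzl⟩ := h
    simp only [List.mem_cons, not_or] at hzl
    have := ih (ht.sublist (verts_contract_sublist l t)) ⟨z, mem_leaves_contract ht hz hzl.1, hzl.2⟩
    rw [leaves_contract (leaves_nodup ht) (ne_leaf_of_mem hz hzl.1), List.filter_filter] at this
    rw [prune, List.foldl_cons]
    refine this.trans (List.filter_congr fun v _ => ?_)
    simp [Bool.and_comm]

/-- A leaf outside `ls` in each child prevents either child from becoming the contracted leaf, so
the root is never deleted. -/
theorem prune_node {r : V} {a b : BTree V} (ht : (node r a b).verts.Nodup) {ls : List V}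
    (ha : ∃ z ∈ a.leaves, z ∉ ls) (hb : ∃ z ∈ b.leaves, z ∉ ls) :
    (node r a b).prune ls = node r (a.prune ls) (b.prune ls) := by
  induction ls generalizing a b with
  | nil => rfl
  | cons l ls ih =>
    obtain ⟨z, hz, hzl⟩ := ha
    obtain ⟨z', hz', hzl'⟩ := hb
    simp only [List.mem_cons, not_or] at hzl hzl'
    have hc : (node r a b).contract l = node r (a.contract l) (b.contract l) := by
      rcases contract_node_cases l r a b with ⟨h, -⟩ | ⟨h, -⟩ | ⟨-, -, h⟩
      · exact absurd h (ne_leaf_of_mem hz hzl.1)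
      · exact absurd h (ne_leaf_of_mem hz' hzl'.1)
      · exact h
    have hv := ht.sublist (verts_contract_sublist l (node r a b))
    rw [hc] at hv
    simp only [verts, List.nodup_cons, List.nodup_append] at ht
    have := ih hv ⟨z, mem_leaves_contract ht.2.1 hz hzl.1, hzl.2⟩
      ⟨z', mem_leaves_contract ht.2.2.1 hz' hzl'.1, hzl'.2⟩
    simp only [prune, List.foldl_cons, hc] at this ⊢
    exact this

theorem prune_leaf (v : V) (ls : List V) : (leaf v).prune ls = leaf v := by
  induction ls with
  | nil => rfl
  | cons l ls ih => exact ih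

/-- The first alternative occurs when the subtree is or becomes a single leaf, which is not counted
as proper. -/
theorem properLeaves_prune {t : BTree V} (ht : t.verts.Nodup) {ls : List V}
    (h : ∃ z ∈ t.leaves, z ∉ ls) : (t.prune ls).properLeaves = [] ∨
      (t.prune ls).properLeaves = t.properLeaves.filter (fun v => v ∉ ls) := by
  cases t with
  | leaf v => left; rw [prune_leaf]; rfl
  | node v a b =>
    by_cases hp : ((node v a b).prune ls).properLeaves = []
    · exact Or.inl hp
    · right
      rw [properLeaves_eq_leaves hp, leaves_prune ht h]
      rfl

theorem exists_site_of_prune {t : BTree V} {O : V → Prop} (ht : t.verts.Nodup)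
    (hO : Sparse O t.leaves) {ls : List V} (hls : ∀ l ∈ ls, O l)
    (h : ∃ z ∈ t.leaves, z ∉ ls) {q : V} {x : Site V} (hx : x ∈ (t.prune ls).sitesBelow q)
    (hxO : O x.l) : ∃ y ∈ t.sitesBelow q, y.l = x.l ∧ y.side = x.side := by
  induction ls generalizing t with
  | nil => exact ⟨x, hx, rfl, rfl⟩
  | cons l ls ih =>
    obtain ⟨z, hz, hzl⟩ := h
    simp only [List.mem_cons, not_or, forall_eq_or_imp] at hzl hls
    have hO' : Sparse O (t.contract l).leaves := by
      rw [leaves_contract (leaves_nodup ht) (ne_leaf_of_mem hz hzl.1)]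
      refine hO.filter fun v _ hv => ?_
      simp only [ne_eq, decide_not, Bool.not_eq_eq_eq_not, Bool.not_true, decide_eq_false_iff_not]
      rintro rfl
      exact hv hls.1
    obtain ⟨y, hy, h₁, h₂⟩ := ih (ht.sublist (verts_contract_sublist l t)) hO' hls.2
      ⟨z, mem_leaves_contract ht hz hzl.1, hzl.2⟩ hx
    obtain ⟨y', hy', h₃, h₄⟩ := exists_site_of_contract hO hls.1 hy (by rwa [h₁])
    exact ⟨y', hy', h₃.trans h₁, h₄.trans h₂⟩

end BTree

/-! ### Number of parallel operations -/

/-- `⌈k / c⌉`, the number of parallel operations needed by `k` operations on `c` processors. -/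
def ceilQuot (k c : ℕ) : ℕ := ⌈(k : ℚ) / c⌉₊

theorem ceilQuot_le_iff {k c N : ℕ} (hc : 0 < c) : ceilQuot k c ≤ N ↔ k ≤ N * c := by
  rw [ceilQuot, Nat.ceil_le, div_le_iff₀ (by exact_mod_cast hc)]
  exact_mod_cast Iff.rfl

theorem le_ceilQuot_mul (k : ℕ) {c : ℕ} (hc : 0 < c) : k ≤ ceilQuot k c * c :=
  (ceilQuot_le_iff hc).mp le_rfl

theorem ceilQuot_mono {k k' : ℕ} (h : k ≤ k') {c : ℕ} (hc : 0 < c) :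
    ceilQuot k c ≤ ceilQuot k' c :=
  (ceilQuot_le_iff hc).mpr (h.trans (le_ceilQuot_mul k' hc))

/-- Each rounding up adds less than one operation, so two of them exceed the rounded total by at
most one. -/
theorem ceilQuot_add_le {k₁ k₂ c N : ℕ} (hc : 0 < c) (h : k₁ + k₂ ≤ N * c) :
    ceilQuot k₁ c + ceilQuot k₂ c ≤ N + 1 := by
  have lower : ∀ k, ceilQuot k c = 0 ∨ (ceilQuot k c - 1) * c < k := fun k => by
    rcases Nat.eq_zero_or_pos (ceilQuot k c) with h | h
    · exact Or.inl h
    · exact Or.inr (not_le.mp fun h' => by have := (ceilQuot_le_iff hc).mpr h'; omega)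
  rcases lower k₁ with h₁ | h₁
  · have := (ceilQuot_le_iff (k := k₂) (N := N) hc).mpr (by omega)
    omega
  rcases lower k₂ with h₂ | h₂
  · have := (ceilQuot_le_iff (k := k₁) (N := N) hc).mpr (by omega)
    omega
  have : (ceilQuot k₁ c - 1 + (ceilQuot k₂ c - 1)) * c < N * c := by
    rw [add_mul]
    omega
  have := lt_of_mul_lt_mul_right this (Nat.zero_le c)
  omega

/-- A bound for the number of parallel operations of the ascending phase from a state with labels
at most `M`, for `c ≤ 2 ^ L` processors. -/
def ascendBound (c L M : ℕ) : ℕ :=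
  if M ≤ 2 * c then 2 * Nat.log 2 M else 2 * (L + 1) + 4 * ceilQuot M (2 * c) - 4

theorem two_mul_log_le {c L M : ℕ} (hL : c ≤ 2 ^ L) (hM : M ≤ 2 * c) :
    2 * Nat.log 2 M ≤ 2 * (L + 1) := by
  have : Nat.log 2 M ≤ Nat.log 2 (2 ^ (L + 1)) :=
    Nat.log_mono_right (by rw [pow_succ]; omega)
  rw [Nat.log_pow one_lt_two] at this
  omega

/-- The potential pays for a round. With `N = ⌈M / 2c⌉`, the two passes cost at most `N + 1`
operations. -/
theorem ascendBound_step {c L M k₁ k₂ : ℕ} (hc : 0 < c) (hL : c ≤ 2 ^ L) (hM : 2 ≤ M)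
    (hk : k₁ + k₂ ≤ (M + 1) / 2) :
    ceilQuot k₁ c + ceilQuot k₂ c + ascendBound c L (M / 2) ≤ ascendBound c L M := by
  have h2c : 0 < 2 * c := by omega
  have hN := le_ceilQuot_mul M h2c
  set N := ceilQuot M (2 * c) with hNdef
  have hsum : ceilQuot k₁ c + ceilQuot k₂ c ≤ N + 1 := by
    refine ceilQuot_add_le hc (hk.trans ?_)
    have : N * (2 * c) = 2 * (N * c) := by ring
    omega
  by_cases h₁ : M ≤ 2 * c
  -- Here each pass has at most `c` shunts, hence costs at most one operation, and the logarithm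
  -- drops by one.
  · have h₁' : M / 2 ≤ 2 * c := by omega
    have ha : ceilQuot k₁ c ≤ 1 := (ceilQuot_le_iff hc).mpr (by omega)
    have hb : ceilQuot k₂ c ≤ 1 := (ceilQuot_le_iff hc).mpr (by omega)
    have hlog : Nat.log 2 M = Nat.log 2 (M / 2) + 1 := Nat.log_of_one_lt_of_le one_lt_two hM
    rw [ascendBound, ascendBound, if_pos h₁, if_pos h₁', hlog]
    omega
  · have hN2 : 2 ≤ N := by
      by_contra h
      have : ceilQuot M (2 * c) ≤ 1 := by omega
      have := (ceilQuot_le_iff h2c).mp this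
      omega
    rw [ascendBound, ascendBound, if_neg h₁]
    by_cases h₂ : M / 2 ≤ 2 * c
    -- The logarithmic regime starts: its cost is at most `2 * (L + 1)`, and `N + 1 ≤ 4 * N - 4` for
    -- `N ≥ 2`.
    · have := two_mul_log_le hL h₂
      rw [if_pos h₂]
      omega
    · rw [if_neg h₂]
      -- The new quotient is at most `(N + 1) / 2`, so `N + 1 + 4 * ((N + 1) / 2) ≤ 4 * N` is
      -- needed; it holds from `N = 3` on.
      have hN3 : 3 ≤ N := by
        by_contra h
        have : ceilQuot M (2 * c) ≤ 2 := by omega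
        have := (ceilQuot_le_iff h2c).mp this
        omega
      have hhalf : ceilQuot (M / 2) (2 * c) ≤ (N + 1) / 2 := by
        refine (ceilQuot_le_iff h2c).mpr ?_
        have h₃ : N * (2 * c) ≤ 2 * ((N + 1) / 2 * (2 * c)) := by
          rw [← mul_assoc 2]
          exact Nat.mul_le_mul_right _ (by omega)
        omega
      omega

theorem ascendBound_le {c L M N : ℕ} (hc : 0 < c) (hL : c ≤ 2 ^ L) (hN : 1 ≤ N)
    (h : M ≤ N * (2 * c)) : ascendBound c L M ≤ 2 * L + 4 * N := by
  have := (ceilQuot_le_iff (show 0 < 2 * c by omega)).mpr h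
  rw [ascendBound]
  split_ifs with h₁
  · have := two_mul_log_le hL h₁
    omega
  · omega

/-! ### Consecutive labels -/

section Consecutive

variable {V : Type*}

/-- The labels of the elements of the list are consecutive numbers. -/
def Consec (f : V → ℕ) (L : List V) : Prop := L.IsChain (fun u v => f v = f u + 1)

theorem Consec.pairwise_lt {f : V → ℕ} {L : List V} (h : Consec f L) :
    L.Pairwise (fun u v => f u < f v) := by
  have h₁ : (L.map f).IsChain (· < ·) :=
    (List.isChain_map f).mpr (List.IsChain.imp (fun u v huv => by omega) h)
  exact List.pairwise_map.mp (List.isChain_iff_pairwise.mp h₁)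

theorem Consec.sparse {f : V → ℕ} {L : List V} (h : Consec f L) :
    Sparse (fun v => Odd (f v)) L := by
  refine List.IsChain.imp (fun u v huv => ?_) h
  rintro ⟨h₁, h₂⟩
  rw [huv] at h₂
  exact (Nat.not_odd_iff_even.mpr h₁.add_one) h₂

theorem Consec.filter_even {f : V → ℕ} {L : List V} (h : Consec f L) :
    Consec (fun v => f v / 2) (L.filter (fun v => ¬ Odd (f v))) := by
  -- The induction also has to know the first even label, which is the first label or its successor.
  have key : ∀ (L : List V), Consec f L →
      Consec (fun v => f v / 2) (L.filter (fun v => ¬ Odd (f v))) ∧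
        ∀ x ∈ L.head?, ∀ y ∈ (L.filter (fun v => ¬ Odd (f v))).head?,
          f y = if Odd (f x) then f x + 1 else f x := by
    intro L
    induction L with
    | nil => simp [Consec]
    | cons x L ih =>
      intro h
      obtain ⟨h₁, h₂⟩ := List.isChain_cons.mp h
      obtain ⟨ih₁, ih₂⟩ := ih h₂
      by_cases hx : Odd (f x)
      · rw [List.filter_cons_of_neg (by simpa using hx)]
        refine ⟨ih₁, ?_⟩
        simp only [List.head?_cons, Option.mem_def, Option.some.injEq, forall_eq']
        intro y hy
        rcases L with _ | ⟨z, L⟩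
        · simp at hy
        · have hz := h₁ z rfl
          have : ¬ Odd (f z) := by rw [hz, Nat.not_odd_iff_even]; exact hx.add_one
          have h₃ := ih₂ z rfl y hy
          rw [if_neg this] at h₃
          rw [if_pos hx, h₃, hz]
      · rw [List.filter_cons_of_pos (by simpa using hx)]
        refine ⟨List.isChain_cons.mpr ⟨fun y hy => ?_, ih₁⟩, ?_⟩
        · rcases L with _ | ⟨z, L⟩
          · simp at hy
          · have hz := h₁ z rfl
            have : Odd (f z) := by rw [hz]; exact (Nat.not_odd_iff_even.mp hx).add_one
            have h₃ := ih₂ z rfl y hy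
            rw [if_pos this] at h₃
            change f y / 2 = f x / 2 + 1
            omega
        · simp [hx]
  exact (key L h).1

/-- Halving is injective on odd numbers and sends those up to `M` below `(M + 1) / 2`; consecutive
labels are distinct. -/
theorem length_le_of_odd {f : V → ℕ} {L D : List V} {M : ℕ} (hD : Consec f D) (hL : L.Nodup)
    (hLD : ∀ v ∈ L, v ∈ D ∧ Odd (f v)) (hM : ∀ v ∈ D, f v ≤ M) : L.length ≤ (M + 1) / 2 := by
  classical
  have hinj : Set.InjOn f {v | v ∈ D} := by
    have := hD.pairwise_lt
    have hmap : (D.map f).Nodup := List.pairwise_map.mpr (this.imp fun h => h.ne)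
    exact fun u hu v hv huv => List.inj_on_of_nodup_map hmap hu hv huv
  rw [← List.toFinset_card_of_nodup hL, ← Finset.card_range ((M + 1) / 2)]
  refine Finset.card_le_card_of_injOn (fun v => f v / 2) (fun v hv => ?_) ?_
  · obtain ⟨h₁, h₂⟩ := hLD v (by simpa using hv)
    have := hM v h₁
    obtain ⟨j, hj⟩ := h₂
    simp only [Finset.coe_range, Set.mem_Iio]
    omega
  · intro u hu v hv huv
    obtain ⟨h₁, i, hi⟩ := hLD u (by simpa using hu)
    obtain ⟨h₂, j, hj⟩ := hLD v (by simpa using hv)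
    exact hinj h₁ h₂ (by simp only at huv; omega)

theorem consec_idxOf [DecidableEq V] {L : List V} (h : L.Nodup) :
    Consec (fun v => L.idxOf v + 1) L := by
  rw [Consec, List.isChain_iff_getElem]
  intro i hi
  simp [h.idxOf_getElem]

end Consecutive

/-! ### Contraction at all sites of one side -/

namespace BTree

variable {V : Type*} [DecidableEq V]

/-- In the subtrees below the root, no two consecutive leaves satisfy `O`. -/
def SparseBelow (O : V → Prop) (t : BTree V) : Prop :=
  ∀ v a b, t = node v a b → Sparse O a.properLeaves ∧ Sparse O b.properLeaves

theorem SparseBelow.of_deepLeaves {O : V → Prop} {t : BTree V} (h : Sparse O t.deepLeaves) :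
    SparseBelow O t := by
  rintro v a b rfl
  exact ⟨List.IsChain.left_of_append h, List.IsChain.right_of_append h⟩

theorem sparse_leaves {O : V → Prop} {t : BTree V} (h : Sparse O t.properLeaves) :
    Sparse O t.leaves := by
  cases t with
  | leaf v => exact List.isChain_singleton v
  | node v a b => exact h

/-- `ls` lists the leaves with property `O` at which a shunt on side `d` is possible. -/
def IsSideList (O : V → Prop) (d : Side) (t : BTree V) (ls : List V) : Prop :=
  ∀ l, l ∈ ls ↔ O l ∧ ∃ x ∈ t.sites, x.side = d ∧ x.l = l

/-- The extreme leaf of each child of the root escapes the pass, so pruning acts on the two children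
separately. -/
theorem IsSideList.exists_notMem {O : V → Prop} {d : Side} {r : V} {a b : BTree V} {ls : List V}
    (ht : (node r a b).verts.Nodup) (h : IsSideList O d (node r a b) ls) :
    (∃ z ∈ a.leaves, z ∉ ls) ∧ ∃ z ∈ b.leaves, z ∉ ls := by
  have hn := leaves_nodup ht
  simp only [leaves, List.nodup_append] at hn
  constructor
  · obtain ⟨z, hz, h'⟩ := exists_leaf_not_site r hn.1 d
    refine ⟨z, hz, fun hzl => ?_⟩
    obtain ⟨-, x, hx, hs, rfl⟩ := (h z).mp hzl
    rcases List.mem_append.mp hx with hx | hx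
    · exact h' x hx hs rfl
    · exact hn.2.2 _ hz _ (l_mem_leaves hx) rfl
  · obtain ⟨z, hz, h'⟩ := exists_leaf_not_site r hn.2.1 d
    refine ⟨z, hz, fun hzl => ?_⟩
    obtain ⟨-, x, hx, hs, rfl⟩ := (h z).mp hzl
    rcases List.mem_append.mp hx with hx | hx
    · exact hn.2.2 _ (l_mem_leaves hx) _ hz rfl
    · exact h' x hx hs rfl

theorem IsSideList.leaves_prune {O : V → Prop} {d : Side} {t : BTree V} {ls : List V}
    (ht : t.verts.Nodup) (h : IsSideList O d t ls) :
    (t.prune ls).leaves = t.leaves.filter (fun v => v ∉ ls) := by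
  refine BTree.leaves_prune ht ?_
  cases t with
  | leaf v => exact ⟨v, by simp [leaves], fun hv => by simpa [sites] using (h v).mp hv⟩
  | node r a b =>
    obtain ⟨z, hz, h⟩ := (h.exists_notMem ht).1
    exact ⟨z, List.mem_append_left _ hz, h⟩

/-- Equality can fail: a child of the root that shrinks to one leaf contributes no deep leaf. -/
theorem IsSideList.deepLeaves_prune {O : V → Prop} {d : Side} {t : BTree V} {ls : List V}
    (ht : t.verts.Nodup) (h : IsSideList O d t ls) :
    (t.prune ls).deepLeaves <:+: t.deepLeaves.filter (fun v => v ∉ ls) := by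
  cases t with
  | leaf v => rw [prune_leaf]; simp [deepLeaves]
  | node r a b =>
    obtain ⟨ha, hb⟩ := h.exists_notMem ht
    rw [prune_node ht ha hb]
    simp only [verts, List.nodup_cons, List.nodup_append] at ht
    simp only [deepLeaves, List.filter_append]
    rcases properLeaves_prune ht.2.1 ha with h₁ | h₁ <;>
      rcases properLeaves_prune ht.2.2.1 hb with h₂ | h₂ <;> rw [h₁, h₂]
    · simp
    · exact (List.suffix_append _ _).isInfix
    · rw [List.append_nil]
      exact (List.prefix_append _ _).isInfix

theorem IsSideList.sparseBelow_prune {O : V → Prop} {d : Side} {t : BTree V} {ls : List V}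
    (ht : t.verts.Nodup) (h : IsSideList O d t ls) (hO : SparseBelow O t) :
    SparseBelow O (t.prune ls) := by
  cases t with
  | leaf v => rwa [prune_leaf]
  | node r a b =>
    obtain ⟨ha, hb⟩ := h.exists_notMem ht
    rw [prune_node ht ha hb]
    obtain ⟨hOa, hOb⟩ := hO r a b rfl
    simp only [verts, List.nodup_cons, List.nodup_append] at ht
    have key : ∀ t : BTree V, t.verts.Nodup → Sparse O t.properLeaves →
        (∃ z ∈ t.leaves, z ∉ ls) → Sparse O (t.prune ls).properLeaves := by
      intro t ht hO hz
      rcases properLeaves_prune ht hz with h₁ | h₁ <;> rw [h₁]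
      · exact List.isChain_nil
      · refine hO.filter fun v _ hv => ?_
        simpa using fun hv' => hv ((h v).mp hv').1
    rintro r' a' b' ⟨⟩
    exact ⟨key a ht.2.1 hOa ha, key b ht.2.2.1 hOb hb⟩

theorem IsSideList.exists_site {O : V → Prop} {d : Side} {t : BTree V} {ls : List V}
    (ht : t.verts.Nodup) (h : IsSideList O d t ls) (hO : SparseBelow O t) {x : Site V}
    (hx : x ∈ (t.prune ls).sites) (hxO : O x.l) : ∃ y ∈ t.sites, y.l = x.l ∧ y.side = x.side := by
  cases t with
  | leaf v => rw [prune_leaf] at hx; simp [sites] at hx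
  | node r a b =>
    obtain ⟨ha, hb⟩ := h.exists_notMem ht
    rw [prune_node ht ha hb] at hx
    obtain ⟨hOa, hOb⟩ := hO r a b rfl
    simp only [verts, List.nodup_cons, List.nodup_append] at ht
    have hls : ∀ l ∈ ls, O l := fun l hl => ((h l).mp hl).1
    rcases List.mem_append.mp hx with hx | hx
    · obtain ⟨y, hy, h'⟩ := exists_site_of_prune ht.2.1 (sparse_leaves hOa) hls ha hx hxO
      exact ⟨y, List.mem_append_left _ hy, h'⟩
    · obtain ⟨y, hy, h'⟩ := exists_site_of_prune ht.2.2.1 (sparse_leaves hOb) hls hb hx hxO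
      exact ⟨y, List.mem_append_right _ hy, h'⟩

theorem IsSideList.mem_deepLeaves {O : V → Prop} {d : Side} {t : BTree V} {ls : List V}
    (h : IsSideList O d t ls) {l : V} (hl : l ∈ ls) : l ∈ t.deepLeaves := by
  obtain ⟨-, x, hx, -, rfl⟩ := (h l).mp hl
  exact (map_l_sites_perm t).mem_iff.mp (List.mem_map_of_mem hx)

theorem IsSideList.length_add_le {O : V → Prop} {d : Side} {t : BTree V} {ls : List V}
    (ht : t.verts.Nodup) (h : IsSideList O d t ls) (hls : ls.Nodup) :
    ls.length + (t.prune ls).leaves.length ≤ t.leaves.length := by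
  rw [h.leaves_prune ht, ← List.length_append]
  refine (List.subperm_of_subset (hls.append ((leaves_nodup ht).filter _) ?_) ?_).length_le
  · intro v hv hv'
    simp [hv] at hv'
  · intro v hv
    rcases List.mem_append.mp hv with hv | hv
    · exact t.deepLeaves_infix_leaves.subset (h.mem_deepLeaves hv)
    · exact (List.mem_filter.mp hv).1

/-- After contraction on the left and then on the right, no deep leaf with property `O` is left. -/
theorem IsSideList.deepLeaves_prune_prune {O : V → Prop} [DecidablePred O] {t : BTree V}
    {ls₁ ls₂ : List V} (ht : t.verts.Nodup) (hO : SparseBelow O t)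
    (h₁ : IsSideList O Side.left t ls₁) (h₂ : IsSideList O Side.right (t.prune ls₁) ls₂) :
    ((t.prune ls₁).prune ls₂).deepLeaves <:+: t.deepLeaves.filter (fun v => ¬ O v) := by
  have hd₁ := h₁.deepLeaves_prune ht
  have hd₂ := h₂.deepLeaves_prune (ht.sublist (verts_prune_sublist t ls₁))
  -- A deep leaf with property `O` left by the first pass had the same side before it. Were it a
  -- left child, the first pass would have removed it; so the second pass does.
  have hmem : ∀ v ∈ (t.prune ls₁).deepLeaves, O v → v ∈ ls₂ := by
    intro v hv hvO
    have hv' := (map_l_sites_perm (t.prune ls₁)).mem_iff.mpr hv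
    obtain ⟨x, hx, rfl⟩ := List.mem_map.mp hv'
    refine (h₂ _).mpr ⟨hvO, x, hx, ?_, rfl⟩
    obtain ⟨y, hy, hyl, hys⟩ := h₁.exists_site ht hO hx hvO
    cases hs : x.side with
    | right => rfl
    | left =>
      have h₃ : x.l ∈ ls₁ := (h₁ _).mpr ⟨hvO, y, hy, hys.trans hs, hyl⟩
      have h₄ := (List.mem_filter.mp (hd₁.subset hv)).2
      simp [h₃] at h₄
  have e₂ : (t.prune ls₁).deepLeaves.filter (fun v => v ∉ ls₂) =
      (t.prune ls₁).deepLeaves.filter (fun v => ¬ O v) := by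
    refine List.filter_congr fun v hv => ?_
    have : v ∈ ls₂ ↔ O v := ⟨fun h => ((h₂ v).mp h).1, hmem v hv⟩
    simp [this]
  have e₁ : (t.deepLeaves.filter (fun v => v ∉ ls₁)).filter (fun v => ¬ O v) =
      t.deepLeaves.filter (fun v => ¬ O v) := by
    rw [List.filter_filter]
    refine List.filter_congr fun v _ => ?_
    by_cases hv : O v
    · simp [hv]
    · have : v ∉ ls₁ := fun h => hv ((h₁ v).mp h).1
      simp [hv, this]
  rw [e₂] at hd₂
  rw [← e₁]
  exact hd₂.trans (hd₁.filter _)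

end BTree

/-! ### The run of the algorithm -/

section Run

variable {V X D : Type*} [Fintype X] [DecidableEq X] [DecidableEq D] [DecidableEq V]

/-- The vertices on which a reverse shunt writes. -/
def MarkedPair.writes (m : MarkedPair V X D) : Finset V := {m.l, m.p, m.s}

/-- Two pairs with the same mark are disjoint. -/
def MarkedPair.Indep (m m' : MarkedPair V X D) : Prop :=
  m.w = m'.w → Disjoint m.writes m'.writes

namespace State

/-- The parallel operations performed so far are legal for `c` processors. -/
def Legal (c : ℕ) (S : State V X D) : Prop :=
  ∀ B ∈ S.trace, B.length ≤ c ∧ B.Pairwise Disjoint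

/-- The number of marked pairs with mark `w`. -/
def markCount (M : List (MarkedPair V X D)) (w : ℕ) : ℕ := (M.filter (fun m => m.w = w)).length

/-- What the ascending phase has recorded so far. -/
structure Recorded (c : ℕ) (S : State V X D) : Prop where
  legal : S.Legal c
  mark_le : ∀ m ∈ S.marked, m.w ≤ S.mark
  indep : S.marked.Pairwise MarkedPair.Indep
  length_trace : ((List.range S.mark).map (fun i => ceilQuot (markCount S.marked (i + 1)) c)).sum ≤
    S.trace.length
  length_computed : S.computed.length = 4 * S.marked.length

/-! #### Parallel shunts -/

theorem foldl_writeShunt (w : ℕ) (S S' : State V X D) (B : List (Site V)) :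
    (B.foldl (S.writeShunt w) S').tree = S'.tree.prune (B.map Site.l) ∧
    (B.foldl (S.writeShunt w) S').label = S'.label ∧
    (B.foldl (S.writeShunt w) S').marked = S'.marked ++
      B.map (fun x => ⟨w, x.l, x.p, x.s, x.side, S.shuntKeep x x.s⟩) ∧
    (B.foldl (S.writeShunt w) S').computed.length = S'.computed.length + 4 * B.length := by
  induction B generalizing S' with
  | nil => simp [BTree.prune]
  | cons x B ih =>
    obtain ⟨h₁, h₂, h₃, h₄⟩ := ih (S.writeShunt w S' x)
    rw [List.foldl_cons, h₁, h₂, h₃, h₄]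
    refine ⟨rfl, rfl, by simp [writeShunt], ?_⟩
    simp only [writeShunt, List.length_append, List.length_cons, List.length_nil]
    omega

theorem foldl_parShunt (w : ℕ) (S : State V X D) (L : List (List (Site V))) :
    (L.foldl (parShunt w) S).tree = S.tree.prune (L.flatten.map Site.l) ∧
    (L.foldl (parShunt w) S).label = S.label ∧
    (∃ N : List (MarkedPair V X D), (L.foldl (parShunt w) S).marked = S.marked ++ N ∧
      (∀ m ∈ N, m.w = w) ∧ N.map MarkedPair.writes = L.flatten.map Site.writes) ∧
    (L.foldl (parShunt w) S).computed.length = S.computed.length + 4 * L.flatten.length ∧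
    (L.foldl (parShunt w) S).trace = S.trace ++ L.map (fun B => B.map Site.writes) := by
  induction L generalizing S with
  | nil => exact ⟨rfl, rfl, ⟨[], by simp⟩, rfl, by simp⟩
  | cons B L ih =>
    obtain ⟨h₁, h₂, ⟨N, h₃, h₄, h₅⟩, h₆, h₇⟩ := ih (S.parShunt w B)
    obtain ⟨k₁, k₂, k₃, k₄⟩ := foldl_writeShunt w S S B
    rw [List.foldl_cons, h₁, h₂, h₃, h₆, h₇]
    refine ⟨?_, k₂, ⟨_, by simp only [parShunt]; rw [k₃, List.append_assoc], ?_, ?_⟩, ?_, ?_⟩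
    · simp only [parShunt]
      rw [k₁]
      simp [BTree.prune, List.foldl_append]
    · intro m hm
      rcases List.mem_append.mp hm with hm | hm
      · obtain ⟨x, -, rfl⟩ := List.mem_map.mp hm
        rfl
      · exact h₄ m hm
    · simp [h₅, Function.comp_def, MarkedPair.writes, Site.writes]
    · simp only [parShunt]
      rw [k₄]
      simp only [List.flatten_cons, List.length_append]
      omega
    · simp only [parShunt, List.append_assoc]
      rfl

theorem markCount_append (M N : List (MarkedPair V X D)) (w : ℕ) :
    markCount (M ++ N) w = markCount M w + markCount N w := by simp [markCount]

theorem markCount_eq_zero {M : List (MarkedPair V X D)} {w : ℕ} (h : ∀ m ∈ M, m.w ≠ w) :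
    markCount M w = 0 := by
  simpa [markCount, List.length_eq_zero_iff, List.filter_eq_nil_iff] using h

theorem markCount_eq_length {M : List (MarkedPair V X D)} {w : ℕ} (h : ∀ m ∈ M, m.w = w) :
    markCount M w = M.length := by
  rw [markCount, List.filter_eq_self.mpr (by simpa using h)]

variable {c : ℕ}

/-- The sites at which shunts are performed on side `d`. -/
def sideSites (d : Side) (S : State V X D) : List (Site V) :=
  S.tree.sites.filter (fun x => x.side = d ∧ Odd (S.label x.l))

theorem ascendSide_tree (σ : Scheduler c (Site V)) (d : Side) (S : State V X D) :
    ∃ ls : List V, ls.Perm ((S.sideSites d).map Site.l) ∧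
      (S.ascendSide σ d).tree = S.tree.prune ls :=
  ⟨_, (σ.perm _).map Site.l, (foldl_parShunt _ S _).1⟩

theorem ascendSide_label (σ : Scheduler c (Site V)) (d : Side) (S : State V X D) :
    (S.ascendSide σ d).label = S.label := (foldl_parShunt _ S _).2.1

theorem ascendSide_length (σ : Scheduler c (Site V)) (d : Side) (S : State V X D) :
    (S.ascendSide σ d).marked.length = S.marked.length + (S.sideSites d).length ∧
    (S.ascendSide σ d).trace.length = S.trace.length + ceilQuot (S.sideSites d).length c := by
  obtain ⟨-, -, ⟨N, h₃, -, h₅⟩, -, h₇⟩ :=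
    foldl_parShunt (S.mark + 1) S (σ.batches (S.sideSites d))
  have hN := congrArg List.length h₅
  rw [List.length_map, List.length_map, (σ.perm _).length_eq] at hN
  constructor
  · exact (congrArg List.length h₃).trans (by rw [List.length_append, hN])
  · refine (congrArg List.length h₇).trans ?_
    rw [List.length_append, List.length_map, σ.count]
    rfl

theorem Recorded.ascendSide {S : State V X D} (h : S.Recorded c) (σ : Scheduler c (Site V))
    (d : Side) (hd : (S.sideSites d).Pairwise (fun x y => Disjoint x.writes y.writes)) :
    (S.ascendSide σ d).Recorded c := by
  have hdis : (σ.batches (S.sideSites d)).flatten.Pairwise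
      (fun x y => Disjoint x.writes y.writes) :=
    ((σ.perm _).pairwise_iff fun h => h.symm).mpr hd
  have hlen := (ascendSide_length σ d S).2
  obtain ⟨-, -, ⟨N, h₃, h₄, h₅⟩, h₆, h₇⟩ :=
    foldl_parShunt (S.mark + 1) S (σ.batches (S.sideSites d))
  have hN := congrArg List.length h₅
  rw [List.length_map, List.length_map] at hN
  change (S.ascendSide σ d).marked = _ at h₃
  change (S.ascendSide σ d).computed.length = _ at h₆
  change (S.ascendSide σ d).trace = _ at h₇
  have hmark : (S.ascendSide σ d).mark = S.mark + 1 := rfl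
  refine ⟨?_, ?_, ?_, ?_, ?_⟩
  · rw [Legal, h₇]
    intro B hB
    rcases List.mem_append.mp hB with hB | hB
    · exact h.legal B hB
    · obtain ⟨A, hA, rfl⟩ := List.mem_map.mp hB
      refine ⟨by simpa using σ.length_le _ A hA, List.pairwise_map.mpr ?_⟩
      exact (List.pairwise_flatten.mp hdis).1 A hA
  · rw [h₃, hmark]
    intro m hm
    rcases List.mem_append.mp hm with hm | hm
    · exact (h.mark_le m hm).trans (Nat.le_succ _)
    · exact (h₄ m hm).le
  · rw [h₃]
    refine List.pairwise_append.mpr ⟨h.indep, ?_, fun m hm m' hm' hw => ?_⟩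
    · have : (N.map MarkedPair.writes).Pairwise Disjoint := by
        rw [h₅]
        exact List.pairwise_map.mpr hdis
      exact (List.pairwise_map.mp this).imp (S := MarkedPair.Indep) fun h _ => h
    -- The new mark exceeds all old ones, so an old and a new pair never share a mark.
    · have := h.mark_le m hm
      have := h₄ m' hm'
      omega
  · rw [hlen, hmark, List.range_succ, List.map_append, List.sum_append, h₃]
    refine Nat.add_le_add (le_trans (le_of_eq ?_) h.length_trace) ?_
    · refine congrArg List.sum (List.map_congr_left fun i hi => ?_)
      have hi := List.mem_range.mp hi
      rw [markCount_append, markCount_eq_zero (M := N) fun m hm => by rw [h₄ m hm]; omega,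
        add_zero]
    · rw [List.map_singleton, List.sum_singleton, markCount_append,
        markCount_eq_zero (M := S.marked) fun m hm => by have := h.mark_le m hm; omega,
        markCount_eq_length h₄, zero_add, hN, (σ.perm _).length_eq]
  · rw [h₃, h₆, List.length_append, hN, h.length_computed]
    ring

/-! #### The ascending phase -/

/-- The labels of the leaves of depth greater than `1` are consecutive numbers between `1` and
`M`. -/
structure Labelled (M : ℕ) (S : State V X D) : Prop where
  nodup : S.tree.verts.Nodup
  consec : Consec S.label S.tree.deepLeaves
  range : ∀ v ∈ S.tree.deepLeaves, 1 ≤ S.label v ∧ S.label v ≤ M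

theorem isSideList_of_perm {S : State V X D} {d : Side} {ls : List V}
    (h : ls.Perm ((S.sideSites d).map Site.l)) :
    BTree.IsSideList (fun v => Odd (S.label v)) d S.tree ls := by
  intro l
  rw [h.mem_iff, List.mem_map]
  simp only [sideSites, List.mem_filter, decide_eq_true_eq]
  constructor
  · rintro ⟨x, ⟨hx, hs, ho⟩, rfl⟩
    exact ⟨ho, x, hx, hs, rfl⟩
  · rintro ⟨ho, x, hx, hs, rfl⟩
    exact ⟨x, ⟨hx, hs, ho⟩, rfl⟩

theorem nodup_of_perm {S : State V X D} (hS : S.tree.verts.Nodup) {d : Side} {ls : List V}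
    (h : ls.Perm ((S.sideSites d).map Site.l)) : ls.Nodup := by
  have h₁ : (S.tree.sites.map Site.l).Nodup :=
    (BTree.map_l_sites_perm _).nodup_iff.mpr
      ((BTree.leaves_nodup hS).sublist S.tree.deepLeaves_infix_leaves.sublist)
  exact h.nodup_iff.mpr (h₁.sublist (List.filter_sublist.map _))

theorem pairwise_sideSites {S : State V X D} (hS : S.tree.verts.Nodup)
    (hO : BTree.SparseBelow (fun v => Odd (S.label v)) S.tree) (d : Side) :
    (S.sideSites d).Pairwise (fun x y => Disjoint x.writes y.writes) := by
  have h : (S.sideSites d).Pairwise (Site.Indep (fun v => Odd (S.label v))) :=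
    (BTree.pairwise_indep_sites hS hO).sublist List.filter_sublist
  refine h.imp_of_mem fun hx hy hxy => ?_
  simp only [sideSites, List.mem_filter, decide_eq_true_eq] at hx hy
  exact hxy (hx.2.1.trans hy.2.1.symm) hx.2.2 hy.2.2

/-- The effect of one execution of the body of the while loop. -/
theorem Labelled.ascendBody {M : ℕ} {S : State V X D} (hS : S.Labelled M) (hR : S.Recorded c)
    (σ : Scheduler c (Site V)) :
    (S.ascendBody σ).Labelled (M / 2) ∧ (S.ascendBody σ).Recorded c ∧
      (S.ascendBody σ).marked.length + (S.ascendBody σ).tree.leaves.length ≤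
        S.marked.length + S.tree.leaves.length ∧
      ∃ k₁ k₂, k₁ + k₂ ≤ (M + 1) / 2 ∧
        (S.ascendBody σ).trace.length = S.trace.length + ceilQuot k₁ c + ceilQuot k₂ c := by
  set O : V → Prop := fun v => Odd (S.label v) with hOdef
  set S₁ := S.ascendSide σ Side.left with hS₁
  set S₂ := S₁.ascendSide σ Side.right with hS₂
  have hbody : S.ascendBody σ = S₂.shiftLabels := rfl
  obtain ⟨ls₁, hp₁, ht₁⟩ := ascendSide_tree σ Side.left S
  obtain ⟨ls₂, hp₂, ht₂⟩ := ascendSide_tree σ Side.right S₁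
  rw [← hS₁] at ht₁
  rw [← hS₂] at ht₂
  have hl₁ : S₁.label = S.label := ascendSide_label σ Side.left S
  have hl₂ : S₂.label = S.label := (ascendSide_label σ Side.right S₁).trans hl₁
  have hv₁ : S₁.tree.verts.Nodup := by
    rw [ht₁]
    exact hS.nodup.sublist (BTree.verts_prune_sublist _ _)
  have hv₂ : S₂.tree.verts.Nodup := by
    rw [ht₂]
    exact hv₁.sublist (BTree.verts_prune_sublist _ _)
  have hO : BTree.SparseBelow O S.tree := BTree.SparseBelow.of_deepLeaves hS.consec.sparse
  have hi₁ : BTree.IsSideList O Side.left S.tree ls₁ := isSideList_of_perm hp₁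
  have hi₂ : BTree.IsSideList O Side.right S₁.tree ls₂ := by
    have := isSideList_of_perm hp₂
    rwa [hl₁] at this
  have hO₁ : BTree.SparseBelow O S₁.tree := by
    rw [ht₁]
    exact hi₁.sparseBelow_prune hS.nodup hO
  have hn₁ := nodup_of_perm hS.nodup hp₁
  have hn₂ := nodup_of_perm hv₁ hp₂
  have hR₁ : S₁.Recorded c := hR.ascendSide σ _ (pairwise_sideSites hS.nodup hO _)
  have hR₂ : S₂.Recorded c := by
    refine hR₁.ascendSide σ _ (pairwise_sideSites hv₁ ?_ _)
    rw [hl₁]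
    exact hO₁
  have hdeep : S₂.tree.deepLeaves <:+: S.tree.deepLeaves.filter (fun v => ¬ O v) := by
    rw [ht₂, ht₁]
    rw [ht₁] at hi₂
    exact hi₁.deepLeaves_prune_prune hS.nodup hO hi₂
  have hsub : ∀ v ∈ S₂.tree.deepLeaves, v ∈ S₂.tree.leaves := fun v hv =>
    S₂.tree.deepLeaves_infix_leaves.subset hv
  have hlabel : ∀ v ∈ S₂.tree.deepLeaves, S₂.shiftLabels.label v = S.label v / 2 := by
    intro v hv
    simp only [shiftLabels, if_pos (hsub v hv), hl₂]
  have hlen₁ := ascendSide_length σ Side.left S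
  have hlen₂ := ascendSide_length σ Side.right S₁
  rw [← hS₁] at hlen₁
  rw [← hS₂] at hlen₂
  have hk₁ : ls₁.length = (S.sideSites Side.left).length := by
    rw [hp₁.length_eq, List.length_map]
  have hk₂ : ls₂.length = (S₁.sideSites Side.right).length := by
    rw [hp₂.length_eq, List.length_map]
  rw [hbody]
  refine ⟨⟨hv₂, ?_, ?_⟩, ⟨hR₂.legal, hR₂.mark_le, hR₂.indep, hR₂.length_trace,
    hR₂.length_computed⟩, ?_, (S.sideSites Side.left).length, (S₁.sideSites Side.right).length,
    ?_, ?_⟩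
  · have h₁ : Consec (fun v => S.label v / 2) S₂.tree.deepLeaves :=
      List.IsChain.infix hS.consec.filter_even hdeep
    refine (List.IsChain.imp_of_mem_imp (fun u v hu hv huv => ?_) h₁ :)
    rw [hlabel u hu, hlabel v hv]
    exact huv
  · intro v hv
    rw [hlabel v hv]
    obtain ⟨hvd, hve⟩ := List.mem_filter.mp (hdeep.subset hv)
    obtain ⟨h₁, h₂⟩ := hS.range v hvd
    have hve : Even (S.label v) := by simpa [hOdef] using hve
    obtain ⟨j, hj⟩ := hve
    omega
  · have h₁ := hi₁.length_add_le hS.nodup hn₁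
    have h₂ := hi₂.length_add_le hv₁ hn₂
    rw [← ht₁] at h₁
    rw [← ht₂] at h₂
    change S₂.marked.length + S₂.tree.leaves.length ≤ _
    omega
  -- The two passes use distinct odd leaves, all of them deep at the start of the round.
  · rw [← hk₁, ← hk₂, ← List.length_append]
    have hd₁ := hi₁.deepLeaves_prune hS.nodup
    rw [← ht₁] at hd₁
    have hmem₂ : ∀ v ∈ ls₂, v ∈ S.tree.deepLeaves ∧ v ∉ ls₁ := fun v hv => by
      simpa using hd₁.subset (hi₂.mem_deepLeaves hv)
    refine length_le_of_odd hS.consec (hn₁.append hn₂ fun v hv hv' => (hmem₂ v hv').2 hv) ?_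
      fun v hv => (hS.range v hv).2
    intro v hv
    rcases List.mem_append.mp hv with hv | hv
    · exact ⟨hi₁.mem_deepLeaves hv, ((hi₁ v).mp hv).1⟩
    · exact ⟨(hmem₂ v hv).1, ((hi₂ v).mp hv).1⟩
  · change S₂.trace.length = _
    rw [hlen₂.2, hlen₁.2]

theorem exists_ascends (hc : 0 < c) {L : ℕ} (hL : c ≤ 2 ^ L) (σ : Scheduler c (Site V)) {M : ℕ}
    {S : State V X D} (hS : S.Labelled M) (hR : S.Recorded c) :
    ∃ S', Ascends σ S S' ∧ S'.Recorded c ∧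
      S'.marked.length + S'.tree.leaves.length ≤ S.marked.length + S.tree.leaves.length ∧
      S'.trace.length ≤ S.trace.length + ascendBound c L M := by
  induction M using Nat.strong_induction_on generalizing S with
  | _ M ih =>
    by_cases hdepth : S.tree.depth ≤ 1
    · exact ⟨S, Ascends.done S hdepth, hR, le_rfl, Nat.le_add_right _ _⟩
    -- At depth greater than `1` there are two deep leaves with consecutive positive labels; hence
    -- `M / 2 < M` and the induction on `M` applies.
    · have hM : 2 ≤ M := by
        have h₁ := BTree.two_le_length_deepLeaves (not_le.mp hdepth)
        have h₂ := hS.consec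
        have h₃ := hS.range
        rcases hD : S.tree.deepLeaves with _ | ⟨u, _ | ⟨v, D⟩⟩ <;> rw [hD] at h₁ h₂ h₃
        · simp at h₁
        · simp at h₁
        · have h₄ : S.label v = S.label u + 1 := (List.isChain_cons_cons.mp h₂).1
          have h₅ := h₃ u (by simp)
          have h₆ := h₃ v (by simp)
          omega
      obtain ⟨hB, hBR, hlen, k₁, k₂, hk, htr⟩ := hS.ascendBody hR σ
      obtain ⟨S', h₁, h₂, h₃, h₄⟩ := ih (M / 2) (by omega) hB hBR
      refine ⟨S', Ascends.step S S' (not_le.mp hdepth) h₁, h₂, h₃.trans hlen, ?_⟩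
      have := ascendBound_step hc hL hM hk
      omega

/-! #### The descending phase -/

theorem foldl_writeRshunt (S S' : State V X D) (B : List (MarkedPair V X D)) :
    (B.foldl S.writeRshunt S').marked.Sublist S'.marked ∧
    (B.foldl S.writeRshunt S').computed.length = S'.computed.length + 2 * B.length := by
  induction B generalizing S' with
  | nil => simp
  | cons m B ih =>
    obtain ⟨h₁, h₂⟩ := ih (S.writeRshunt S' m)
    refine ⟨h₁.trans List.filter_sublist, ?_⟩
    rw [List.foldl_cons, h₂]
    simp only [writeRshunt, List.length_append, List.length_cons, List.length_nil]
    omega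

theorem foldl_parRshunt (S : State V X D) (L : List (List (MarkedPair V X D))) :
    (L.foldl parRshunt S).marked.Sublist S.marked ∧
    (L.foldl parRshunt S).computed.length = S.computed.length + 2 * L.flatten.length ∧
    (L.foldl parRshunt S).trace = S.trace ++ L.map (fun B => B.map MarkedPair.writes) := by
  induction L generalizing S with
  | nil => simp
  | cons B L ih =>
    obtain ⟨h₁, h₂, h₃⟩ := ih (S.parRshunt B)
    obtain ⟨k₁, k₂⟩ := foldl_writeRshunt S S B
    refine ⟨h₁.trans k₁, ?_, ?_⟩
    · rw [List.foldl_cons, h₂]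
      simp only [parRshunt]
      rw [k₂]
      simp only [List.flatten_cons, List.length_append]
      omega
    · rw [List.foldl_cons, h₃]
      simp only [parRshunt, List.append_assoc]
      rfl

/-- The list `M` stands for the pairs marked at the end of the ascending phase; reverse shunts only
delete pairs, so every count is compared with this fixed list. -/
theorem descendMark_spec (hc : 0 < c) (τ : Scheduler c (MarkedPair V X D)) (S : State V X D)
    (w : ℕ) {M : List (MarkedPair V X D)} (hM : S.marked.Sublist M)
    (hI : M.Pairwise MarkedPair.Indep) (hS : S.Legal c) :
    (S.descendMark τ w).marked.Sublist M ∧ (S.descendMark τ w).Legal c ∧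
    (S.descendMark τ w).computed.length ≤ S.computed.length + 2 * markCount M w ∧
    (S.descendMark τ w).trace.length ≤ S.trace.length + ceilQuot (markCount M w) c := by
  set A := S.marked.filter (fun m => m.w = w) with hA
  have hAM : A.Sublist M := List.filter_sublist.trans hM
  have hlen : A.length ≤ markCount M w := (hM.filter _).length_le
  have hdis : (τ.batches A).flatten.Pairwise (fun m m' => Disjoint m.writes m'.writes) := by
    refine ((τ.perm A).pairwise_iff fun h => h.symm).mpr ?_
    refine (hI.sublist hAM).imp_of_mem fun hm hm' h => h ?_
    simp only [hA, List.mem_filter, decide_eq_true_eq] at hm hm'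
    exact hm.2.trans hm'.2.symm
  obtain ⟨h₁, h₂, h₃⟩ := foldl_parRshunt S (τ.batches A)
  change (S.descendMark τ w).marked.Sublist _ at h₁
  change (S.descendMark τ w).computed.length = _ at h₂
  change (S.descendMark τ w).trace = _ at h₃
  refine ⟨h₁.trans hM, ?_, ?_, ?_⟩
  · rw [Legal, h₃]
    intro B hB
    rcases List.mem_append.mp hB with hB | hB
    · exact hS B hB
    · obtain ⟨B', hB', rfl⟩ := List.mem_map.mp hB
      refine ⟨by simpa using τ.length_le _ B' hB', List.pairwise_map.mpr ?_⟩
      exact (List.pairwise_flatten.mp hdis).1 B' hB'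
  · rw [h₂, (τ.perm A).length_eq]
    omega
  · rw [h₃, List.length_append, List.length_map, τ.count]
    exact Nat.add_le_add_left (ceilQuot_mono hlen hc) _

theorem foldl_descendMark (hc : 0 < c) (τ : Scheduler c (MarkedPair V X D)) (S : State V X D)
    (W : List ℕ) {M : List (MarkedPair V X D)} (hM : S.marked.Sublist M)
    (hI : M.Pairwise MarkedPair.Indep) (hS : S.Legal c) :
    (W.foldl (descendMark τ) S).Legal c ∧
    (W.foldl (descendMark τ) S).computed.length ≤
      S.computed.length + 2 * (W.map (markCount M)).sum ∧
    (W.foldl (descendMark τ) S).trace.length ≤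
      S.trace.length + (W.map (fun w => ceilQuot (markCount M w) c)).sum := by
  induction W generalizing S with
  | nil => exact ⟨hS, by simp, by simp⟩
  | cons w W ih =>
    obtain ⟨h₁, h₂, h₃, h₄⟩ := descendMark_spec hc τ S w hM hI hS
    obtain ⟨k₁, k₂, k₃⟩ := ih (S.descendMark τ w) h₁ h₂
    rw [List.foldl_cons]
    refine ⟨k₁, ?_, ?_⟩ <;> rw [List.map_cons, List.sum_cons] <;> omega

theorem sum_markCount_le (M : List (MarkedPair V X D)) (k : ℕ) :
    ((List.range k).map (fun i => markCount M (i + 1))).sum ≤ M.length := by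
  -- Restricting to marks at most `k` makes the induction on `k` work.
  refine le_trans ?_ (List.length_filter_le (fun m => decide (m.w ≤ k)) M)
  induction k with
  | zero => simp
  | succ k ih =>
    rw [List.range_succ, List.map_append, List.sum_append, List.map_singleton, List.sum_singleton]
    refine (Nat.add_le_add_right ih _).trans ?_
    rw [markCount]
    clear ih
    induction M with
    | nil => simp
    | cons m M ih =>
      simp only [List.filter_cons, decide_eq_true_eq]
      split_ifs <;> first | omega | (simp only [List.length_cons]; omega)

theorem descend_spec (hc : 0 < c) (τ : Scheduler c (MarkedPair V X D)) {S : State V X D}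
    (hI : S.marked.Pairwise MarkedPair.Indep) (hS : S.Legal c) :
    (S.descend τ).Legal c ∧
    (S.descend τ).computed.length ≤ S.computed.length + 2 * S.marked.length ∧
    (S.descend τ).trace.length ≤ S.trace.length +
      ((List.range S.mark).map (fun i => ceilQuot (markCount S.marked (i + 1)) c)).sum := by
  obtain ⟨h₁, h₂, h₃⟩ := foldl_descendMark hc τ S
    ((List.range S.mark).reverse.map (fun i => i + 1)) (List.Sublist.refl _) hI hS
  have h₄ := sum_markCount_le S.marked S.mark
  have hsum : ∀ f : ℕ → ℕ, (((List.range S.mark).reverse.map (fun i => i + 1)).map f).sum =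
      ((List.range S.mark).map (fun i => f (i + 1))).sum := fun f => by
    rw [List.map_reverse, List.map_reverse, List.sum_reverse, List.map_map]
    rfl
  rw [hsum] at h₂ h₃
  exact ⟨h₁, h₂.trans (by omega), h₃⟩

theorem middle_spec (S : State V X D) : S.middle.marked = S.marked ∧ S.middle.mark = S.mark ∧
    S.middle.trace = S.trace ∧ S.middle.computed.length ≤ S.computed.length + 3 := by
  unfold middle
  split <;> simp

end State

/-! ### Assembly of the bounds -/

variable {J : CSP X D}

theorem EJoinTree.labelled_initial (T : EJoinTree J V) :
    T.initial.Labelled T.tree.leaves.length := by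
  have hn := BTree.leaves_nodup T.nodup
  refine ⟨T.nodup, List.IsChain.infix (consec_idxOf hn) T.tree.deepLeaves_infix_leaves,
    fun v hv => ⟨Nat.le_add_left _ _, ?_⟩⟩
  exact List.idxOf_lt_length_iff.mpr (T.tree.deepLeaves_infix_leaves.subset hv)

theorem EJoinTree.recorded_initial (T : EJoinTree J V) (c : ℕ) : T.initial.Recorded c := by
  refine ⟨?_, ?_, ?_, ?_, ?_⟩ <;> simp [State.Legal, EJoinTree.initial]

theorem EJoinTree.exists_globalConsistency (T : EJoinTree J V) {c L N : ℕ} (hc : 0 < c)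
    (hL : c ≤ 2 ^ L) (hN : T.size ≤ N * (4 * c)) (σ : Scheduler c (Site V))
    (τ : Scheduler c (MarkedPair V X D)) :
    ∃ F : State V X D, GlobalConsistency σ τ T F ∧ F.Legal c ∧
      F.trace.length ≤ 4 * (L + 2 * N) ∧ F.computed.length ≤ 9 * T.size ∧
      ∀ R ∈ F.computed, R.card ≤ J.maxRelSize ^ 2 := by
  obtain ⟨S, hA, hR, hlen, htr⟩ :=
    State.exists_ascends hc hL σ T.labelled_initial (T.recorded_initial c)
  obtain ⟨m₁, m₂, m₃, m₄⟩ := State.middle_spec S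
  have hI : S.middle.marked.Pairwise MarkedPair.Indep := by rw [m₁]; exact hR.indep
  have hLeg : S.middle.Legal c := by rw [State.Legal, m₃]; exact hR.legal
  obtain ⟨h₁, h₂, h₃⟩ := State.descend_spec hc τ hI hLeg
  have hsize : T.size + 1 = 2 * T.tree.leaves.length := T.tree.length_verts_add_one
  refine ⟨S.middle.descend τ, ⟨S, hA, rfl⟩, h₁, ?_, ?_,
    ((hA.small T.small_initial).middle.descend τ).computed⟩
  · have hN1 : 1 ≤ N := by
      by_contra h
      have : N = 0 := by omega
      subst this
      omega
    -- There are `(n + 1) / 2` leaves and `n ≤ 4 * c * N`.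
    have hM : T.tree.leaves.length ≤ N * (2 * c) := by
      have : N * (4 * c) = 2 * (N * (2 * c)) := by ring
      omega
    have hb := ascendBound_le hc hL hN1 hM
    have h₀ : T.initial.trace.length = 0 := rfl
    -- The descending phase costs no more than the ascending one, so the total is at most twice `2 *
    -- L + 4 * N`.
    have h₄ := hR.length_trace
    rw [m₁, m₂, m₃] at h₃
    omega
  -- Four relations per shunt, two per reverse shunt and three in between; with at most `(n - 1) /
  -- 2` shunts this is at most `3 * n`.
  · have h₀ : T.initial.marked.length = 0 := rfl
    have h₀' : T.initial.tree = T.tree := rfl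
    rw [h₀, h₀'] at hlen
    rw [m₁] at h₂
    have := hR.length_computed
    have := List.length_pos_iff.mpr S.tree.leaves_ne_nil
    omega

end Run

end GlobCons

theorem mainTheorem9 :
    ∃ K : ℕ, ∀ (X D V : Type*) [Fintype X] [DecidableEq X] [DecidableEq D] [DecidableEq V]
      (J : GlobCons.CSP X D) (T : GlobCons.EJoinTree J V) (c : ℕ) (_hc : 1 ≤ c)
      (σ : GlobCons.Scheduler c (GlobCons.Site V))
      (τ : GlobCons.Scheduler c (GlobCons.MarkedPair V X D)),
      ∃ F : GlobCons.State V X D,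
        GlobCons.GlobalConsistency σ τ T F ∧
        -- each parallel step uses at most `c` processors, with exclusive writes
        (∀ B ∈ F.trace, B.length ≤ c ∧ B.Pairwise Disjoint) ∧
        -- number of parallel (reverse) shunt operations
        F.trace.length ≤
          4 * (⌈Real.logb 2 (c : ℝ)⌉₊ + 2 * ⌈(T.size : ℝ) / (4 * (c : ℝ))⌉₊) ∧
        -- number and size of the intermediate relations
        F.computed.length ≤ K * T.size ∧
        (∀ R ∈ F.computed, R.card ≤ K * J.maxRelSize ^ 2) := by
  refine ⟨9, fun X D V _ _ _ _ J T c hc σ τ => ?_⟩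
  have hc0 : 0 < c := hc
  have hcR : (0 : ℝ) < c := by exact_mod_cast hc0
  have hL : c ≤ 2 ^ ⌈Real.logb 2 (c : ℝ)⌉₊ := by
    have h := (Real.logb_le_iff_le_rpow one_lt_two hcR).mp (Nat.le_ceil (Real.logb 2 (c : ℝ)))
    rw [Real.rpow_natCast] at h
    exact_mod_cast h
  have hN : T.size ≤ ⌈(T.size : ℝ) / (4 * (c : ℝ))⌉₊ * (4 * c) := by
    have h := Nat.le_ceil ((T.size : ℝ) / (4 * (c : ℝ)))
    rw [div_le_iff₀ (by positivity)] at h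
    exact_mod_cast h
  obtain ⟨F, h₁, h₂, h₃, h₄, h₅⟩ := T.exists_globalConsistency hc0 hL hN σ τ
  exact ⟨F, h₁, h₂, h₃, h₄, fun R hR => (h₅ R hR).trans (Nat.le_mul_of_pos_left _ (by norm_num))⟩
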